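/- Let $A$ be a unital $C^*$-algebra and let $M$ be an essential correspondence over $A$: a right Hilbert $A$-module (with $A$-valued inner product linear in the second variable) with a left action of $A$ given by a $*$-homomorphism of $A$ into the adjointable operators on $M$, such that $1\cdot n=n$ for all $n\in M$. A countable family $(x_j)_{j\in J}$ in a Hilbert $A$-module $X$ is a Parseval frame for $X$ if $\langle x,x\rangle=\sum_{j\in J}\langle x,x_j\rangle\langle x_j,x\rangle$ for every $x\in X$, where the finite partial sums converge in norm along the finite subsets of $J$. It is an orthonormal basis for $X$ if $\langle x_i,x_j\rangle=\delta_{i,j}1$ for all $i,j$ and the $A$-linear combinations of the $x_j$ are dense in $X$. Let $(m_j)_{j\in J}$ be a Parseval frame for $M$, indexed by a countable set $J$ with a distinguished element $0\in J$, such that $\langle m_0,m_0\rangle=1$. Let $M^{\otimes 0}=A$, and let $M^{\otimes k}=M\otimes_A\cdots\otimes_A M$ ($k$ factors) be the internal tensor power, that is, the completion of the algebraic tensor product for $\langle m\otimes x,n\otimes y\rangle=\langle\langle n,m\rangle\cdot x,y\rangle$. Define inner-product preserving maps $T_k:M^{\otimes k}\to M^{\otimes(k+1)}$ by $T_kn=m_0\otimes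 n$ (for $k=0$, $T_0a=m_0\cdot a$ under the identification $M\otimes_A A\cong M$). Let $(M_\infty,\iota^k)=\varinjlim(M^{\otimes k},T_k)$ be the Hilbert module direct limit: the completion of the quotient of the disjoint union of the $M^{\otimes k}$ in which each $n\in M^{\otimes k}$ is identified with $T_kn$, with $\iota^k(n)$ the class of $n$. Then the family $$\{\iota^0(1)\}\cup\{\iota^k(m_{j_1}\otimes\cdots\otimes m_{j_k}) : k\ge 1,\ j_1,\dots,j_k\in J,\ j_1\neq 0\},$$ indexed by one point together with the tuples $(j_1,\dots,j_k)$ with $k\geq1$ and $j_1\ne 0$, is a Parseval frame for $M_\infty$. If moreover $(m_j)_{j\in J}$ is an orthonormal basis for $M$, then this family is an orthonormal basis for $M_\infty$. -/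

import Mathlib

open MulOpposite UniformSpace UniformSpace.Completion TensorProduct

universe u v w

set_option linter.unusedSectionVars false

/-- A complex vector space `E` with a right action of `A` (a module over `Aᵐᵒᵖ`, the element
`x · a` being `op a • x`) and an `A`-valued semi-inner product `⟨x, y⟩ = ip A x y`, linear in the
second variable. -/
class PreHilbertModule (A : Type u) (E : Type v) [CStarAlgebra A] [PartialOrder A]
    [AddCommGroup E] [Module ℂ E] [Module Aᵐᵒᵖ E] where
  /-- the `A`-valued (semi-)inner product -/
  ip (A) : E → E → A
  ip_add_right (x y z : E) : ip x (y + z) = ip x y + ip x z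
  ip_smul_right (c : ℂ) (x y : E) : ip x (c • y) = c • ip x y
  ip_op_smul_right (a : A) (x y : E) : ip x (op a • y) = ip x y * a
  star_ip (x y : E) : star (ip x y) = ip y x
  ip_self_nonneg (x : E) : 0 ≤ ip x x


/-- A (right) Hilbert `A`-module: the inner product is definite (as its norm
`‖x‖ = ‖⟨x, x⟩‖ ^ (1 / 2)` is a norm), and the module is complete. -/
class HilbertModule (A : Type u) (E : Type v) [CStarAlgebra A] [PartialOrder A]
    [NormedAddCommGroup E] [NormedSpace ℂ E] [Module Aᵐᵒᵖ E] extends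
    PreHilbertModule A E, CompleteSpace E where
  norm_sq_eq (x : E) : ‖x‖ ^ 2 = ‖ip x x‖

/-- A semi-inner product module with a left action of `A` by adjointable operators, the adjoint of
`x ↦ a • x` being `x ↦ star a • x`. -/
class PreCorrespondence (A : Type u) (E : Type v) [CStarAlgebra A] [PartialOrder A]
    [AddCommGroup E] [Module ℂ E] [Module Aᵐᵒᵖ E] [Module A E] extends
    PreHilbertModule A E where
  smul_assoc_left (c : ℂ) (a : A) (x : E) : (c • a) • x = c • (a • x)
  ip_smul_left (a : A) (x y : E) : ip (a • x) y = ip x (star a • y)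

/-- An essential correspondence over the unital C⋆-algebra `A`: a Hilbert `A`-module together with
a ⋆-homomorphism from `A` to its adjointable operators, written as a left action `a • x`. That the
correspondence is essential, `1 • x = x`, is part of the instance `Module A E`. -/
class EssentialCorrespondence (A : Type u) (E : Type v) [CStarAlgebra A] [PartialOrder A]
    [NormedAddCommGroup E] [NormedSpace ℂ E] [Module Aᵐᵒᵖ E] [Module A E] extends
    HilbertModule A E, PreCorrespondence A E

namespace PreHilbertModule

section Basic

variable (A : Type u) {E : Type v} [CStarAlgebra A] [PartialOrder A] [StarOrderedRing A]
  [AddCommGroup E] [Module ℂ E] [Module Aᵐᵒᵖ E] [PreHilbertModule A E]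

theorem ip_add_left (x y z : E) : ip A (x + y) z = ip A x z + ip A y z := by
  rw [← star_ip, ip_add_right, star_add, star_ip, star_ip]

theorem ip_smul_left' (c : ℂ) (x y : E) : ip A (c • x) y = star c • ip A x y := by
  rw [← star_ip, ip_smul_right, star_smul, star_ip]

theorem ip_op_smul_left (a : A) (x y : E) : ip A (op a • x) y = star a * ip A x y := by
  rw [← star_ip, ip_op_smul_right, star_mul, star_ip]

theorem ip_zero_right (x : E) : ip A x 0 = 0 := by
  have h := ip_smul_right (A := A) 0 x (0 : E)
  simpa using h

theorem ip_zero_left (x : E) : ip A 0 x = 0 := by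
  rw [← star_ip, ip_zero_right, star_zero]

theorem ip_neg_right (x y : E) : ip A x (-y) = -ip A x y := by
  have h := ip_smul_right (A := A) (-1) x y
  simpa using h

theorem ip_sub_right (x y z : E) : ip A x (y - z) = ip A x y - ip A x z := by
  rw [sub_eq_add_neg, ip_add_right, ip_neg_right, sub_eq_add_neg]

theorem ip_sub_left (x y z : E) : ip A (x - y) z = ip A x z - ip A y z := by
  rw [← star_ip, ip_sub_right, star_sub, star_ip, star_ip]

/-- The seminorm `‖⟨x, x⟩‖ ^ (1 / 2)`. -/
noncomputable def seminorm (x : E) : ℝ := √‖ip A x x‖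

theorem seminorm_sq (x : E) : seminorm A x ^ 2 = ‖ip A x x‖ := Real.sq_sqrt (norm_nonneg _)

theorem cauchySchwarz_aux (x y : E) (t : ℝ) (ht : 0 ≤ 2 * t - t ^ 2 * ‖ip A x x‖) :
    (2 * t - t ^ 2 * ‖ip A x x‖) * ‖ip A x y‖ ^ 2 ≤ ‖ip A y y‖ := by
  set s : A := ip A x y with hs
  have hs' : ip A y x = star s := (star_ip x y).symm
  have h0 := ip_self_nonneg (A := A) (y - op ((t : ℂ) • s) • x)
  rw [ip_sub_right, ip_sub_left, ip_sub_left, ip_op_smul_right, ip_op_smul_left,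
    ip_op_smul_left, ip_op_smul_right, hs', ← hs] at h0
  have h1 : star s * ip A x x * s ≤ ‖ip A x x‖ • (star s * s) := by
    have := CStarAlgebra.star_left_conjugate_le_norm_smul (a := s) (b := ip A x x)
      (hb := star_ip x x)
    simpa using this
  have h2 : (2 * t - t ^ 2 * ‖ip A x x‖) • (star s * s) ≤ ip A y y := by
    have h3 : t ^ 2 • (star s * ip A x x * s) ≤ t ^ 2 • (‖ip A x x‖ • (star s * s)) := by
      gcongr
    have h4 : 0 ≤ ip A y y - (2 * t) • (star s * s) + t ^ 2 • (star s * ip A x x * s) := by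
      refine h0.trans_eq ?_
      simp only [Complex.coe_smul, star_smul, star_trivial, smul_mul_assoc, mul_smul_comm,
        smul_smul, mul_assoc, two_mul, add_smul, pow_two]
      abel
    have h5 := h4.trans (add_le_add_right h3 _)
    rw [sub_smul, mul_smul (t ^ 2)]
    rw [← sub_nonneg]
    refine h5.trans_eq ?_
    abel
  have h6 := CStarAlgebra.norm_le_norm_of_nonneg_of_le
    (smul_nonneg ht (star_mul_self_nonneg s)) h2
  rwa [norm_smul, CStarRing.norm_star_mul_self, ← pow_two, Real.norm_of_nonneg ht] at h6

theorem norm_ip_sq_le (x y : E) : ‖ip A x y‖ ^ 2 ≤ ‖ip A x x‖ * ‖ip A y y‖ := by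
  rcases (norm_nonneg (ip A x x)).eq_or_lt with h | h
  · rw [← h, zero_mul]
    by_contra! hc
    have h1 := cauchySchwarz_aux A x y ((‖ip A y y‖ + 1) / (2 * ‖ip A x y‖ ^ 2)) (by
      rw [← h]; simp only [mul_zero, sub_zero]; positivity)
    rw [← h] at h1
    have : (2 * ((‖ip A y y‖ + 1) / (2 * ‖ip A x y‖ ^ 2)) -
      ((‖ip A y y‖ + 1) / (2 * ‖ip A x y‖ ^ 2)) ^ 2 * 0) * ‖ip A x y‖ ^ 2 = ‖ip A y y‖ + 1 := by
      rw [mul_zero, sub_zero, ← mul_div_assoc, mul_div_mul_left _ _ two_ne_zero,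
        div_mul_cancel₀ _ hc.ne']
    linarith
  · have h1 := cauchySchwarz_aux A x y (‖ip A x x‖⁻¹) (by
      have : 2 * ‖ip A x x‖⁻¹ - ‖ip A x x‖⁻¹ ^ 2 * ‖ip A x x‖ = ‖ip A x x‖⁻¹ := by
        field_simp; ring
      rw [this]; positivity)
    have : 2 * ‖ip A x x‖⁻¹ - ‖ip A x x‖⁻¹ ^ 2 * ‖ip A x x‖ = ‖ip A x x‖⁻¹ := by
      field_simp; ring
    rwa [this, inv_mul_le_iff₀ h] at h1

theorem norm_ip_le (x y : E) : ‖ip A x y‖ ≤ seminorm A x * seminorm A y := by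
  rw [seminorm, seminorm, ← Real.sqrt_mul (norm_nonneg _)]
  exact Real.le_sqrt_of_sq_le (norm_ip_sq_le A x y)

theorem seminorm_core : @SeminormedSpace.Core ℂ E _ _ ⟨seminorm A⟩ _ :=
  letI : Norm E := ⟨seminorm A⟩
  { norm_nonneg := fun x => Real.sqrt_nonneg _
    norm_smul := fun c x => by
      change √‖ip A (c • x) (c • x)‖ = ‖c‖ * √‖ip A x x‖
      rw [ip_smul_right, ip_smul_left', smul_smul, norm_smul, norm_mul, norm_star,
        Real.sqrt_mul (by positivity), Real.sqrt_mul_self (norm_nonneg _)]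
    norm_triangle := fun x y => by
      change seminorm A (x + y) ≤ seminorm A x + seminorm A y
      have hn : 0 ≤ seminorm A x + seminorm A y :=
        add_nonneg (Real.sqrt_nonneg _) (Real.sqrt_nonneg _)
      refine abs_le_of_sq_le_sq' ?_ hn |>.2
      rw [seminorm_sq, ip_add_right, ip_add_left, ip_add_left]
      change _ ≤ (seminorm A x + seminorm A y) ^ 2
      have h1 := norm_ip_le A x y
      have h2 := norm_ip_le A y x
      have h3 := seminorm_sq A x
      have h4 := seminorm_sq A y
      have h5 := norm_add₃_le (a := ip A x x) (b := ip A y x) (c := ip A x y + ip A y y)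
      have h6 := norm_add_le (ip A x y) (ip A y y)
      rw [← add_assoc] at h5 ⊢
      nlinarith }

end Basic

section Completion

variable (A : Type u) (E : Type v) [CStarAlgebra A] [PartialOrder A]
  [AddCommGroup E] [Module ℂ E] [Module Aᵐᵒᵖ E] [PreHilbertModule A E]

/-- The space `E` with the seminorm `‖⟨x, x⟩‖ ^ (1 / 2)`. -/
def Seminormed (_A : Type u) (E : Type v) : Type v := E

variable [StarOrderedRing A]

noncomputable instance : SeminormedAddCommGroup (Seminormed A E) :=
  letI : Norm E := ⟨seminorm A⟩
  (SeminormedAddCommGroup.ofCore (𝕜 := ℂ) (E := E) (seminorm_core A))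

noncomputable instance : NormedSpace ℂ (Seminormed A E) :=
  { (inferInstance : Module ℂ E) with
    norm_smul_le := fun c x =>
      (@SeminormedSpace.Core.norm_smul ℂ E _ _ ⟨seminorm A⟩ _ (seminorm_core A) c x).le }

noncomputable instance : Module Aᵐᵒᵖ (Seminormed A E) := (inferInstance : Module Aᵐᵒᵖ E)

noncomputable instance : PreHilbertModule A (Seminormed A E) :=
  { (inferInstance : PreHilbertModule A E) with }

variable {E}

theorem Seminormed.norm_sq_eq (x : Seminormed A E) : ‖x‖ ^ 2 = ‖ip A x x‖ :=
  seminorm_sq A (E := E) x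

theorem Seminormed.norm_ip_le (x y : Seminormed A E) : ‖ip A x y‖ ≤ ‖x‖ * ‖y‖ :=
  PreHilbertModule.norm_ip_le A (E := E) x y

variable (E)

theorem Seminormed.uniformContinuous_of_norm_le {R : Type w} [Ring R] [Module R (Seminormed A E)]
    (h : ∀ r : R, ∃ C : ℝ, ∀ x : Seminormed A E, ‖r • x‖ ≤ C * ‖x‖) :
    UniformContinuousConstSMul R (Seminormed A E) :=
  ⟨fun r => by
    obtain ⟨C, hC⟩ := h r
    exact uniformContinuous_of_continuousAt_zero
      (DistribSMul.toAddMonoidHom (Seminormed A E) r)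
      (AddMonoidHomClass.continuous_of_bound
        (DistribSMul.toAddMonoidHom (Seminormed A E) r) C hC).continuousAt⟩

noncomputable instance : UniformContinuousConstSMul Aᵐᵒᵖ (Seminormed A E) :=
  Seminormed.uniformContinuous_of_norm_le A E fun r => ⟨‖unop r‖, fun x => by
    refine abs_le_of_sq_le_sq' ?_ (by positivity) |>.2
    rw [mul_pow, Seminormed.norm_sq_eq A, Seminormed.norm_sq_eq A]
    obtain ⟨a, rfl⟩ := op_surjective r
    rw [ip_op_smul_right, ip_op_smul_left, unop_op]
    calc ‖star a * ip A x x * a‖ ≤ ‖star a‖ * ‖ip A x x‖ * ‖a‖ :=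
          (norm_mul_le _ _).trans (by gcongr; exact norm_mul_le _ _)
      _ = ‖a‖ ^ 2 * ‖ip A x x‖ := by rw [norm_star]; ring⟩

/-- The inner product as a biadditive map. -/
noncomputable def ipHom : Seminormed A E →+ Seminormed A E →+ A :=
  AddMonoidHom.mk' (fun x => AddMonoidHom.mk' (fun y => ip A x y) (ip_add_right x))
    fun x y => by ext z; exact ip_add_left A x y z

theorem continuous_ipHom :
    Continuous fun p : Seminormed A E × Seminormed A E => ipHom A E p.1 p.2 := by
  let f : Seminormed A E →ₗ⋆[ℂ] Seminormed A E →ₗ[ℂ] A :=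
    LinearMap.mk₂'ₛₗ (starRingEnd ℂ) (RingHom.id ℂ) (fun x y => ip A x y)
      (ip_add_left A) (ip_smul_left' A) ip_add_right ip_smul_right
  let hf := (f.mkContinuous₂ 1 fun x y => by
    rw [one_mul]
    exact Seminormed.norm_ip_le A x y)
  exact (hf.continuous.comp continuous_fst).clm_apply continuous_snd

/-- The completion of a semi-inner product module: vectors of length zero are divided out and the
quotient is completed in the norm `‖⟨x, x⟩‖ ^ (1 / 2)`. -/
def HilbertCompletion : Type v := Completion (Seminormed A E)

noncomputable instance : NormedAddCommGroup (HilbertCompletion A E) :=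
  inferInstanceAs (NormedAddCommGroup (Completion (Seminormed A E)))

noncomputable instance : NormedSpace ℂ (HilbertCompletion A E) :=
  inferInstanceAs (NormedSpace ℂ (Completion (Seminormed A E)))

noncomputable instance : Module Aᵐᵒᵖ (HilbertCompletion A E) :=
  inferInstanceAs (Module Aᵐᵒᵖ (Completion (Seminormed A E)))

instance : CompleteSpace (HilbertCompletion A E) :=
  inferInstanceAs (CompleteSpace (Completion (Seminormed A E)))

variable {E}

/-- The image of a vector in the completion. -/
noncomputable def toCompletion (x : E) : HilbertCompletion A E := Completion.coe' (α := Seminormed A E) x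

/-- The inner product of the completion, extended by continuity. -/
noncomputable def completionIp (x y : HilbertCompletion A E) : A :=
  ((isDenseInducing_toCompl (Seminormed A E)).prodMap
    (isDenseInducing_toCompl (Seminormed A E))).extend (fun p => ipHom A E p.1 p.2) (x, y)

theorem completionIp_coe (x y : E) :
    completionIp A (toCompletion A x) (toCompletion A y) = ip A x y :=
  ((isDenseInducing_toCompl (Seminormed A E)).prodMap
    (isDenseInducing_toCompl (Seminormed A E))).extend_eq (continuous_ipHom A E) (x, y)

variable (E) in
theorem continuous_completionIp :
    Continuous fun p : HilbertCompletion A E × HilbertCompletion A E =>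
      completionIp A p.1 p.2 :=
  (isDenseInducing_toCompl (Seminormed A E)).extend_Z_bilin
    (isDenseInducing_toCompl (Seminormed A E)) (continuous_ipHom A E)

theorem toCompletion_add (x y : E) :
    toCompletion A (x + y) = toCompletion A x + toCompletion A y :=
  Completion.coe_add (α := Seminormed A E) x y

theorem toCompletion_smul (c : ℂ) (x : E) : toCompletion A (c • x) = c • toCompletion A x :=
  Completion.coe_smul (X := Seminormed A E) c x

theorem toCompletion_op_smul (a : A) (x : E) :
    toCompletion A (op a • x) = op a • toCompletion A x :=
  Completion.coe_smul (X := Seminormed A E) (op a) x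

variable (E) in
theorem denseRange_toCompletion : DenseRange (toCompletion A (E := E)) :=
  Completion.denseRange_coe (α := Seminormed A E)

variable (E) in
instance : ContinuousConstSMul Aᵐᵒᵖ (HilbertCompletion A E) :=
  inferInstanceAs (ContinuousConstSMul Aᵐᵒᵖ (Completion (Seminormed A E)))

theorem continuous_completionIp_comp {α : Type w} [TopologicalSpace α] {f g : α → HilbertCompletion A E}
    (hf : Continuous f) (hg : Continuous g) :
    Continuous fun t => completionIp A (f t) (g t) :=
  (continuous_completionIp A E).comp (hf.prodMk hg)

theorem norm_toCompletion_sq (x : E) : ‖toCompletion A x‖ ^ 2 = ‖ip A x x‖ := by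
  have h := Completion.norm_coe (E := Seminormed A E) x
  exact (congrArg (· ^ 2) h).trans (Seminormed.norm_sq_eq A x)

variable (E)

noncomputable instance : HilbertModule A (HilbertCompletion A E) where
  ip := completionIp A
  ip_add_right x y z := by
    refine (denseRange_toCompletion A E).induction_on₃
      (p := fun x y z => completionIp A x (y + z) = completionIp A x y + completionIp A x z)
      (isClosed_eq
        (continuous_completionIp_comp A (continuous_fst) (continuous_snd.fst.add continuous_snd.snd))
        ((continuous_completionIp_comp A (continuous_fst) (continuous_snd.fst)).add (continuous_completionIp_comp A (continuous_fst) (continuous_snd.snd)))) (fun x y z => ?_) x y z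
    rw [← toCompletion_add, completionIp_coe, completionIp_coe, completionIp_coe, ip_add_right]
  ip_smul_right c x y := by
    refine (denseRange_toCompletion A E).induction_on₂
      (p := fun x y => completionIp A x (c • y) = c • completionIp A x y)
      (isClosed_eq (continuous_completionIp_comp A (continuous_fst) (continuous_snd.const_smul c))
        ((continuous_completionIp_comp A (continuous_fst) (continuous_snd)).const_smul c)) (fun x y => ?_) x y
    rw [← toCompletion_smul, completionIp_coe, completionIp_coe, ip_smul_right]
  ip_op_smul_right a x y := by
    refine (denseRange_toCompletion A E).induction_on₂
      (p := fun x y => completionIp A x (op a • y) = completionIp A x y * a)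
      (isClosed_eq (continuous_completionIp_comp A (continuous_fst) (continuous_snd.const_smul (op a)))
        ((continuous_completionIp_comp A (continuous_fst) (continuous_snd)).mul continuous_const)) (fun x y => ?_) x y
    rw [← toCompletion_op_smul, completionIp_coe, completionIp_coe, ip_op_smul_right]
  star_ip x y := by
    refine (denseRange_toCompletion A E).induction_on₂
      (p := fun x y => star (completionIp A x y) = completionIp A y x)
      (isClosed_eq (continuous_completionIp_comp A (continuous_fst) (continuous_snd)).star
        (continuous_completionIp_comp A (continuous_snd) (continuous_fst))) (fun x y => ?_) x y
    rw [completionIp_coe, completionIp_coe, star_ip]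
  ip_self_nonneg x := by
    refine (denseRange_toCompletion A E).induction_on
      (p := fun x => 0 ≤ completionIp A x x) x
      (CStarAlgebra.isClosed_nonneg.preimage
        (continuous_completionIp_comp A (continuous_id) (continuous_id))) (fun x => ?_)
    rw [completionIp_coe]
    exact ip_self_nonneg x
  norm_sq_eq x := by
    refine (denseRange_toCompletion A E).induction_on
      (p := fun x => ‖x‖ ^ 2 = ‖completionIp A x x‖) x
      (isClosed_eq (continuous_norm.pow 2)
        (continuous_completionIp_comp A (continuous_id) (continuous_id)).norm) (fun x => ?_)
    rw [completionIp_coe, norm_toCompletion_sq]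

theorem ip_toCompletion (x y : E) :
    ip A (toCompletion A x) (toCompletion A y) = ip A x y :=
  completionIp_coe A x y

end Completion

section LeftAction

variable (A : Type u) (E : Type v) [CStarAlgebra A] [PartialOrder A] [StarOrderedRing A]
  [AddCommGroup E] [Module ℂ E] [Module Aᵐᵒᵖ E] [Module A E] [PreCorrespondence A E]

noncomputable instance : Module A (Seminormed A E) := (inferInstance : Module A E)

variable {E} in
theorem norm_ip_left_smul_le (a : A) (x : E) :
    ‖ip A (a • x) (a • x)‖ ≤ ‖a‖ ^ 2 * ‖ip A x x‖ := by
  have h1 : 0 ≤ algebraMap ℝ A (‖a‖ ^ 2) - star a * a := by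
    rw [sub_nonneg, pow_two, ← CStarRing.norm_star_mul_self]
    exact (IsSelfAdjoint.star_mul_self a).le_algebraMap_norm_self
  obtain ⟨c, hc⟩ := CStarAlgebra.nonneg_iff_eq_star_mul_self.mp h1
  have h2 : ip A (a • x) (a • x) ≤ (‖a‖ ^ 2) • ip A x x := by
    have h3 : 0 ≤ ip A (c • x) (c • x) := ip_self_nonneg _
    rw [PreCorrespondence.ip_smul_left, smul_smul, ← hc, sub_smul, ip_sub_right,
      Algebra.algebraMap_eq_smul_one, ← Complex.coe_smul, PreCorrespondence.smul_assoc_left,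
      one_smul, ip_smul_right, sub_nonneg, Complex.coe_smul] at h3
    rwa [PreCorrespondence.ip_smul_left, smul_smul]
  refine (CStarAlgebra.norm_le_norm_of_nonneg_of_le (ip_self_nonneg _) h2).trans_eq ?_
  rw [norm_smul, Real.norm_of_nonneg (by positivity)]

instance : UniformContinuousConstSMul A (Seminormed A E) :=
  Seminormed.uniformContinuous_of_norm_le A E fun a => ⟨‖a‖, fun x => by
    refine abs_le_of_sq_le_sq' ?_ (by positivity) |>.2
    rw [mul_pow, Seminormed.norm_sq_eq A, Seminormed.norm_sq_eq A]
    exact norm_ip_left_smul_le A (E := E) a x⟩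

noncomputable instance : Module A (HilbertCompletion A E) :=
  inferInstanceAs (Module A (Completion (Seminormed A E)))

instance : ContinuousConstSMul A (HilbertCompletion A E) :=
  inferInstanceAs (ContinuousConstSMul A (Completion (Seminormed A E)))

variable {E} in
theorem toCompletion_left_smul (a : A) (x : E) :
    toCompletion A (a • x) = a • toCompletion A x :=
  Completion.coe_smul (X := Seminormed A E) a x

noncomputable instance : EssentialCorrespondence A (HilbertCompletion A E) where
  smul_assoc_left c a x := by
    refine (denseRange_toCompletion A E).induction_on
      (p := fun x => (c • a) • x = c • (a • x)) x
      (isClosed_eq (continuous_const_smul _) ((continuous_const_smul c).comp (continuous_const_smul a))) (fun x => ?_)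
    rw [← toCompletion_left_smul, ← toCompletion_left_smul, ← toCompletion_smul,
      PreCorrespondence.smul_assoc_left]
  ip_smul_left a x y := by
    refine (denseRange_toCompletion A E).induction_on₂
      (p := fun x y => completionIp A (a • x) y = completionIp A x (star a • y))
      (isClosed_eq (continuous_completionIp_comp A (continuous_fst.const_smul a) (continuous_snd))
        (continuous_completionIp_comp A (continuous_fst) (continuous_snd.const_smul (star a)))) (fun x y => ?_) x y
    rw [← toCompletion_left_smul, ← toCompletion_left_smul, completionIp_coe, completionIp_coe,
      PreCorrespondence.ip_smul_left]

end LeftAction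

end PreHilbertModule

namespace PreHilbertModule

section GramMatrix

variable (A : Type u) {E : Type v} [CStarAlgebra A] [PartialOrder A] [StarOrderedRing A]
  [AddCommGroup E] [Module ℂ E] [Module Aᵐᵒᵖ E] [PreHilbertModule A E]

theorem ip_sum_right {ι : Type w} (s : Finset ι) (x : E) (y : ι → E) :
    ip A x (∑ i ∈ s, y i) = ∑ i ∈ s, ip A x (y i) :=
  map_sum (AddMonoidHom.mk' (fun y => ip A x y) (ip_add_right x)) y s

theorem ip_sum_left {ι : Type w} (s : Finset ι) (x : ι → E) (y : E) :
    ip A (∑ i ∈ s, x i) y = ∑ i ∈ s, ip A (x i) y :=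
  map_sum (AddMonoidHom.mk' (fun x => ip A x y) fun x x' => ip_add_left A x x' y) x s

/-- A selfadjoint element `G` is of the form `B⋆ * B` as soon as its negative part `N = D⋆ * D`
vanishes. -/
theorem exists_negPart_factor {R : Type w} [NonUnitalCStarAlgebra R] (G : R) (hG : star G = G) :
    ∃ N D : R, star N = N ∧ star (D * N) * (D * N) = -(N * G * N) ∧ (D * N = 0 → N = 0) ∧
      (N = 0 → ∃ B : R, G = star B * B) := by
  let _ := CStarAlgebra.spectralOrder R
  have _ := CStarAlgebra.spectralOrderedRing R
  have hG' : IsSelfAdjoint G := hG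
  have hpos := CFC.posPart_sub_negPart G hG'
  have hn : star G⁻ = G⁻ := (CFC.negPart_nonneg G).isSelfAdjoint
  obtain ⟨D, hD⟩ := CStarAlgebra.nonneg_iff_eq_star_mul_self.mp (CFC.negPart_nonneg G)
  have h1 : G⁻ * G = -(G⁻ * G⁻) := by
    calc G⁻ * G = G⁻ * (G⁺ - G⁻) := by rw [hpos]
      _ = -(G⁻ * G⁻) := by rw [mul_sub, CFC.negPart_mul_posPart, zero_sub]
  refine ⟨G⁻, D, hn, ?_, fun h => ?_, fun h => ?_⟩
  · rw [h1, star_mul, hn, neg_mul, neg_neg]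
    calc G⁻ * star D * (D * G⁻) = G⁻ * (star D * D) * G⁻ := by simp only [mul_assoc]
      _ = G⁻ * G⁻ * G⁻ := by rw [← hD]
  · have h2 : star G⁻ * G⁻ = 0 := by
      rw [hn]
      nth_rw 1 [hD]
      rw [mul_assoc, h, mul_zero]
    exact CStarRing.star_mul_self_eq_zero_iff _ |>.mp h2
  · refine CStarAlgebra.nonneg_iff_eq_star_mul_self.mp ?_
    rw [← hpos, h, sub_zero]
    exact CFC.posPart_nonneg G

theorem cstarMatrix_eq_zero_of_diag {ι : Type w} [Fintype ι] [DecidableEq ι]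
    (C : CStarMatrix ι ι A) (h : ∀ k, (star C * C) k k ≤ 0) : C = 0 := by
  ext i k
  have h1 : (star C * C) k k = ∑ l, star (C l k) * C l k := by
    simp [CStarMatrix.mul_apply, CStarMatrix.star_apply]
  have h2 : ∀ l ∈ Finset.univ, 0 ≤ star (C l k) * C l k := fun l _ => star_mul_self_nonneg _
  have h3 : ∑ l, star (C l k) * C l k = 0 :=
    le_antisymm (h1 ▸ h k) (Finset.sum_nonneg h2)
  have h4 := (Finset.sum_eq_zero_iff_of_nonneg h2).mp h3 i (Finset.mem_univ i)
  simpa using h4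

/-- Gram matrices are positive: `⟨x i, x j⟩ = ∑ k, (B k i)⋆ * B k j` for some matrix `B`. -/
theorem exists_gram_factor {ι : Type w} [Fintype ι] [DecidableEq ι] (x : ι → E) :
    ∃ B : ι → ι → A, ∀ i j, ip A (x i) (x j) = ∑ k, star (B k i) * B k j := by
  let G : CStarMatrix ι ι A := CStarMatrix.ofMatrix fun i j => ip A (x i) (x j)
  have hGe : ∀ i j, G i j = ip A (x i) (x j) := fun i j => rfl
  have hG : star G = G := by
    ext i j
    rw [CStarMatrix.star_apply, hGe, hGe, star_ip]
  obtain ⟨N, D, hN, h1, h2, h3⟩ := exists_negPart_factor G hG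
  have hNe : ∀ i j, star (N i j) = N j i := fun i j => by
    rw [← CStarMatrix.star_apply, hN]
  have h4 : D * N = 0 := by
    refine cstarMatrix_eq_zero_of_diag A _ fun k => ?_
    have h5 : (N * G * N) k k =
        ip A (∑ i, op (N i k) • x i) (∑ j, op (N j k) • x j) := by
      simp only [CStarMatrix.mul_apply, ip_sum_left, ip_sum_right, ip_op_smul_left,
        ip_op_smul_right, hGe, Finset.sum_mul, hNe, mul_assoc]
    have h6 : (star (D * N) * (D * N)) k k = -((N * G * N) k k) := by rw [h1]; rfl
    rw [h6, h5, neg_nonpos]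
    exact ip_self_nonneg _
  obtain ⟨B, hB⟩ := h3 (h2 h4)
  refine ⟨fun k i => B k i, fun i j => ?_⟩
  rw [← hGe, hB, CStarMatrix.mul_apply]
  simp only [CStarMatrix.star_apply]

end GramMatrix

end PreHilbertModule

namespace HilbertModule

open PreHilbertModule

variable (A : Type u) {E : Type v} [CStarAlgebra A] [PartialOrder A] [StarOrderedRing A]
  [NormedAddCommGroup E] [NormedSpace ℂ E] [Module Aᵐᵒᵖ E] [HilbertModule A E]

theorem eq_of_ip_right (x y : E) (h : ∀ z : E, ip A z x = ip A z y) : x = y := by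
  have h1 : ‖x - y‖ ^ 2 = 0 := by
    rw [norm_sq_eq (A := A), ip_sub_right, h, sub_self, norm_zero]
  exact sub_eq_zero.mp (norm_eq_zero.mp (pow_eq_zero_iff two_ne_zero |>.mp h1))

theorem op_smul_comm (a : A) (c : ℂ) (x : E) : op a • c • x = c • op a • x :=
  eq_of_ip_right A _ _ fun z => by
    rw [ip_op_smul_right, ip_smul_right, ip_smul_right, ip_op_smul_right, smul_mul_assoc]

end HilbertModule

namespace PreCorrespondence

variable {A : Type u} {E : Type v} [CStarAlgebra A] [PartialOrder A]
    [AddCommGroup E] [Module ℂ E] [Module Aᵐᵒᵖ E] [Module A E] [PreCorrespondence A E]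

theorem smul_comm_left (a : A) (c : ℂ) (x : E) : a • c • x = c • a • x := by
  have h : c • x = (c • (1 : A)) • x := by rw [smul_assoc_left, one_smul]
  rw [h, smul_smul, mul_smul_comm, mul_one, smul_assoc_left]

end PreCorrespondence

namespace InternalTensor

open PreHilbertModule PreCorrespondence

section Right

variable (A : Type u) (M : Type v) (X : Type w) [CStarAlgebra A] [PartialOrder A]
  [StarOrderedRing A]
  [NormedAddCommGroup M] [NormedSpace ℂ M] [Module Aᵐᵒᵖ M] [HilbertModule A M]
  [NormedAddCommGroup X] [NormedSpace ℂ X] [Module Aᵐᵒᵖ X] [Module A X]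
  [EssentialCorrespondence A X]

/-- The algebraic tensor product `M ⊙ X` over `ℂ`. -/
def Alg (_A : Type u) (M : Type v) (X : Type w) [NormedAddCommGroup M] [NormedSpace ℂ M]
    [NormedAddCommGroup X] [NormedSpace ℂ X] : Type (max v w) := M ⊗[ℂ] X

noncomputable instance : AddCommGroup (Alg A M X) := inferInstanceAs (AddCommGroup (M ⊗[ℂ] X))

noncomputable instance : Module ℂ (Alg A M X) := inferInstanceAs (Module ℂ (M ⊗[ℂ] X))

variable {A M X} in
/-- The elementary tensor `m ⊗ x` of the algebraic tensor product. -/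
def Alg.mk (m : M) (x : X) : Alg A M X := m ⊗ₜ[ℂ] x

variable {M X} in
theorem exists_sum (z : M ⊗[ℂ] X) :
    ∃ (n : ℕ) (m : Fin n → M) (x : Fin n → X), z = ∑ i, m i ⊗ₜ[ℂ] x i := by
  induction z using TensorProduct.induction_on with
  | zero => exact ⟨0, fun _ => 0, fun _ => 0, by simp⟩
  | tmul m x => exact ⟨1, fun _ => m, fun _ => x, by simp⟩
  | add y z hy hz =>
    obtain ⟨n, m, x, rfl⟩ := hy
    obtain ⟨n', m', x', rfl⟩ := hz
    refine ⟨n + n', Fin.append m m', Fin.append x x', ?_⟩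
    simp only [Fin.sum_univ_add, Fin.append_left, Fin.append_right]

/-- The map `x ↦ x · a`, as a `ℂ`-linear map. -/
def opSMul (a : Aᵐᵒᵖ) : X →ₗ[ℂ] X where
  toFun x := a • x
  map_add' := smul_add a
  map_smul' c x := HilbertModule.op_smul_comm A (unop a) c x

/-- The right action `(m ⊗ x) · a = m ⊗ (x · a)`. -/
noncomputable instance : Module Aᵐᵒᵖ (Alg A M X) where
  smul a := (opSMul A X a).lTensor M
  one_smul z := by
    change (opSMul A X 1).lTensor M z = z
    have : opSMul A X 1 = LinearMap.id := by ext x; exact one_smul _ x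
    rw [this, LinearMap.lTensor_id]; rfl
  mul_smul a b z := by
    change (opSMul A X (a * b)).lTensor M z = _
    have : opSMul A X (a * b) = opSMul A X a ∘ₗ opSMul A X b := by ext x; exact mul_smul a b x
    rw [this, LinearMap.lTensor_comp]; rfl
  smul_zero a := map_zero ((opSMul A X a).lTensor M)
  smul_add a := map_add ((opSMul A X a).lTensor M)
  add_smul a b z := by
    change (opSMul A X (a + b)).lTensor M z = _
    have : opSMul A X (a + b) = opSMul A X a + opSMul A X b := by ext x; exact add_smul a b x
    rw [this, LinearMap.lTensor_add]; rfl
  zero_smul z := by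
    change (opSMul A X 0).lTensor M z = 0
    have : opSMul A X 0 = 0 := by ext x; exact zero_smul _ x
    rw [this, LinearMap.lTensor_zero]; rfl

theorem ip_left_smul_smul (c : ℂ) (a : A) (x y : X) :
    ip A ((c • a) • x) y = star c • ip A (a • x) y := by
  rw [smul_assoc_left, ip_smul_left']

/-- The linear functional `n ⊗ y ↦ ⟨⟨n, m⟩ • x, y⟩`. -/
noncomputable def formRight (m : M) (x : X) : M ⊗[ℂ] X →ₗ[ℂ] A :=
  TensorProduct.lift (LinearMap.mk₂ ℂ (fun (n : M) (y : X) => ip A (ip A n m • x) y)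
    (fun n n' y => by rw [ip_add_left A n, add_smul, ip_add_left])
    (fun c n y => by rw [ip_smul_left', ip_left_smul_smul, star_star])
    (fun n y y' => ip_add_right _ _ _)
    (fun c n y => ip_smul_right _ _ _))

/-- The form `⟨m ⊗ x, n ⊗ y⟩ = ⟨⟨n, m⟩ • x, y⟩` on the algebraic tensor product. -/
noncomputable def form : M ⊗[ℂ] X →ₗ⋆[ℂ] M ⊗[ℂ] X →ₗ[ℂ] A :=
  TensorProduct.lift (LinearMap.mk₂'ₛₗ (starRingEnd ℂ) (starRingEnd ℂ) (formRight A M X)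
    (fun m m' x => by
      refine TensorProduct.ext' fun n y => ?_
      change ip A (ip A n (m + m') • x) y = ip A (ip A n m • x) y + ip A (ip A n m' • x) y
      rw [ip_add_right, add_smul, ip_add_left])
    (fun c m x => by
      refine TensorProduct.ext' fun n y => ?_
      change ip A (ip A n (c • m) • x) y = star c • ip A (ip A n m • x) y
      rw [ip_smul_right, ip_left_smul_smul])
    (fun m x x' => by
      refine TensorProduct.ext' fun n y => ?_
      change ip A (ip A n m • (x + x')) y = ip A (ip A n m • x) y + ip A (ip A n m • x') y
      rw [smul_add, ip_add_left])
    (fun c m x => by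
      refine TensorProduct.ext' fun n y => ?_
      change ip A (ip A n m • c • x) y = star c • ip A (ip A n m • x) y
      rw [smul_comm_left, ip_smul_left']))

theorem form_tmul (m n : M) (x y : X) :
    form A M X (m ⊗ₜ x) (n ⊗ₜ y) = ip A (ip A n m • x) y := rfl

theorem form_star (z w : M ⊗[ℂ] X) : star (form A M X z w) = form A M X w z := by
  induction w using TensorProduct.induction_on with
  | zero => rw [map_zero, map_zero, star_zero, LinearMap.zero_apply]
  | add w w' h h' => rw [map_add, map_add, star_add, h, h', LinearMap.add_apply]
  | tmul n y =>
    induction z using TensorProduct.induction_on with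
    | zero => rw [map_zero, map_zero, LinearMap.zero_apply, star_zero]
    | add w w' h h' => rw [map_add, map_add, LinearMap.add_apply, star_add, h, h']
    | tmul m x => rw [form_tmul, form_tmul, star_ip, ip_smul_left, star_ip]

theorem form_self_nonneg (z : M ⊗[ℂ] X) : 0 ≤ form A M X z z := by
  obtain ⟨n, m, x, hz⟩ := exists_sum z
  obtain ⟨B, hB⟩ := exists_gram_factor A m
  have h1 : ∀ i j, ip A (ip A (m j) (m i) • x i) (x j) =
      ∑ k, ip A (B k i • x i) (B k j • x j) := fun i j => by
    rw [hB, Finset.sum_smul, ip_sum_left]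
    refine Finset.sum_congr rfl fun k _ => ?_
    rw [mul_smul, ip_smul_left, star_star]
  have h : form A M X z z = ∑ k, ip A (∑ i, B k i • x i) (∑ j, B k j • x j) := by
    have h2 : form A M X z z = ∑ j, ∑ i, ∑ k, ip A (B k i • x i) (B k j • x j) := by
      rw [hz]
      simp only [map_sum, LinearMap.coe_sum, Finset.sum_apply, form_tmul, h1]
    rw [h2]
    simp only [ip_sum_left, ip_sum_right]
    rw [Finset.sum_comm]
    refine (Finset.sum_congr rfl fun i _ => Finset.sum_comm).trans ?_
    rw [Finset.sum_comm]
    exact Finset.sum_congr rfl fun k _ => Finset.sum_comm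
  rw [h]
  exact Finset.sum_nonneg fun k _ => ip_self_nonneg _

noncomputable instance : PreHilbertModule A (Alg A M X) where
  ip z w := form A M X z w
  ip_add_right z := map_add (form A M X z)
  ip_smul_right c z := map_smul (form A M X z) c
  ip_op_smul_right a z w := by
    change form A M X z ((opSMul A X (op a)).lTensor M w) = form A M X z w * a
    induction w using TensorProduct.induction_on with
    | zero => simp
    | add w w' h h' => rw [map_add, map_add, map_add, h, h', add_mul]
    | tmul n y =>
      induction z using TensorProduct.induction_on with
      | zero => simp
      | add w w' h h' => rw [map_add, LinearMap.add_apply, LinearMap.add_apply, h, h', add_mul]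
      | tmul m x => exact ip_op_smul_right a _ _
  star_ip := form_star A M X
  ip_self_nonneg := form_self_nonneg A M X

theorem Alg.ip_mk_mk (m n : M) (x y : X) :
    ip A (Alg.mk m x : Alg A M X) (Alg.mk n y) = ip A (ip A n m • x) y := rfl

end Right

section Left

variable (A : Type u) (M : Type v) (X : Type w) [CStarAlgebra A] [PartialOrder A]
  [StarOrderedRing A]
  [NormedAddCommGroup M] [NormedSpace ℂ M] [Module Aᵐᵒᵖ M] [Module A M]
  [EssentialCorrespondence A M]
  [NormedAddCommGroup X] [NormedSpace ℂ X] [Module Aᵐᵒᵖ X] [Module A X]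
  [EssentialCorrespondence A X]

/-- The map `m ↦ a • m`, as a `ℂ`-linear map. -/
def leftSMul (a : A) : M →ₗ[ℂ] M where
  toFun x := a • x
  map_add' := smul_add a
  map_smul' c x := smul_comm_left a c x

/-- The left action `a • (m ⊗ x) = (a • m) ⊗ x`. -/
noncomputable instance : Module A (Alg A M X) where
  smul a := (leftSMul A M a).rTensor X
  one_smul z := by
    change (leftSMul A M 1).rTensor X z = z
    have : leftSMul A M 1 = LinearMap.id := by ext x; exact one_smul _ x
    rw [this, LinearMap.rTensor_id]; rfl
  mul_smul a b z := by
    change (leftSMul A M (a * b)).rTensor X z = _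
    have : leftSMul A M (a * b) = leftSMul A M a ∘ₗ leftSMul A M b := by
      ext x; exact mul_smul a b x
    rw [this, LinearMap.rTensor_comp]; rfl
  smul_zero a := map_zero ((leftSMul A M a).rTensor X)
  smul_add a := map_add ((leftSMul A M a).rTensor X)
  add_smul a b z := by
    change (leftSMul A M (a + b)).rTensor X z = _
    have : leftSMul A M (a + b) = leftSMul A M a + leftSMul A M b := by
      ext x; exact add_smul a b x
    rw [this, LinearMap.rTensor_add]; rfl
  zero_smul z := by
    change (leftSMul A M 0).rTensor X z = 0
    have : leftSMul A M 0 = 0 := by ext x; exact zero_smul _ x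
    rw [this, LinearMap.rTensor_zero]; rfl

noncomputable instance : PreCorrespondence A (Alg A M X) where
  smul_assoc_left c a z := by
    change (leftSMul A M (c • a)).rTensor X z = c • (leftSMul A M a).rTensor X z
    have : leftSMul A M (c • a) = c • leftSMul A M a := by
      ext x; exact smul_assoc_left c a x
    rw [this, LinearMap.rTensor_smul]; rfl
  ip_smul_left a z w := by
    change form A M X ((leftSMul A M a).rTensor X z) w =
      form A M X z ((leftSMul A M (star a)).rTensor X w)
    induction w using TensorProduct.induction_on with
    | zero => simp
    | add w w' h h' => rw [map_add, map_add, map_add, h, h']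
    | tmul n y =>
      induction z using TensorProduct.induction_on with
      | zero => simp
      | add w w' h h' =>
        rw [map_add, map_add, map_add, LinearMap.add_apply, LinearMap.add_apply, h, h']
      | tmul m x =>
        change ip A (ip A n (a • m) • x) y = ip A (ip A (star a • n) m • x) y
        have h : ip A (star a • n) m = ip A n (a • m) := by rw [ip_smul_left, star_star]
        rw [h]

end Left

end InternalTensor

open PreHilbertModule

/-- The internal tensor product `M ⊗_A X`: the completion of the algebraic tensor product in the
inner product `⟨m ⊗ x, n ⊗ y⟩ = ⟨⟨n, m⟩ • x, y⟩`. -/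
abbrev InternalTensor (A : Type u) (M : Type v) (X : Type w) [CStarAlgebra A] [PartialOrder A]
    [StarOrderedRing A]
    [NormedAddCommGroup M] [NormedSpace ℂ M] [Module Aᵐᵒᵖ M] [HilbertModule A M]
    [NormedAddCommGroup X] [NormedSpace ℂ X] [Module Aᵐᵒᵖ X] [Module A X]
    [EssentialCorrespondence A X] : Type (max v w) :=
  HilbertCompletion A (InternalTensor.Alg A M X)

/-- The elementary tensor `m ⊗ x` in the internal tensor product. -/
noncomputable def InternalTensor.tmul (A : Type u) {M : Type v} {X : Type w} [CStarAlgebra A]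
    [PartialOrder A] [StarOrderedRing A]
    [NormedAddCommGroup M] [NormedSpace ℂ M] [Module Aᵐᵒᵖ M] [HilbertModule A M]
    [NormedAddCommGroup X] [NormedSpace ℂ X] [Module Aᵐᵒᵖ X] [Module A X]
    [EssentialCorrespondence A X] (m : M) (x : X) : InternalTensor A M X :=
  toCompletion A (InternalTensor.Alg.mk m x)

theorem InternalTensor.ip_tmul_tmul (A : Type u) {M : Type v} {X : Type w} [CStarAlgebra A]
    [PartialOrder A] [StarOrderedRing A]
    [NormedAddCommGroup M] [NormedSpace ℂ M] [Module Aᵐᵒᵖ M] [HilbertModule A M]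
    [NormedAddCommGroup X] [NormedSpace ℂ X] [Module Aᵐᵒᵖ X] [Module A X]
    [EssentialCorrespondence A X] (m n : M) (x y : X) :
    ip A (tmul A m x) (tmul A n y) = ip A (ip A n m • x) y :=
  ip_toCompletion A (Alg A M X) (Alg.mk m x) (Alg.mk n y)

/-- The algebra `A` as an essential correspondence over itself, with `⟨a, b⟩ = a⋆ b`. -/
noncomputable instance EssentialCorrespondence.self (A : Type u) [CStarAlgebra A] [PartialOrder A]
    [StarOrderedRing A] : EssentialCorrespondence A A where
  ip a b := star a * b
  ip_add_right _ _ _ := mul_add _ _ _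
  ip_smul_right _ _ _ := mul_smul_comm _ _ _
  ip_op_smul_right _ _ _ := (mul_assoc _ _ _).symm
  star_ip _ _ := by rw [star_mul, star_star]
  ip_self_nonneg a := star_mul_self_nonneg a
  norm_sq_eq a := by rw [pow_two, CStarRing.norm_star_mul_self]
  smul_assoc_left _ _ _ := smul_mul_assoc _ _ _
  ip_smul_left a x y := by
    change star (a * x) * y = star x * (star a * y)
    rw [star_mul, mul_assoc]

/-- A bundled essential correspondence. -/
structure BundledCorrespondence (A : Type u) [CStarAlgebra A] [PartialOrder A] where
  carrier : Type u
  [normedAddCommGroup : NormedAddCommGroup carrier]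
  [normedSpace : NormedSpace ℂ carrier]
  [rightModule : Module Aᵐᵒᵖ carrier]
  [leftModule : Module A carrier]
  [correspondence : EssentialCorrespondence A carrier]

attribute [instance] BundledCorrespondence.normedAddCommGroup BundledCorrespondence.normedSpace
  BundledCorrespondence.rightModule BundledCorrespondence.leftModule
  BundledCorrespondence.correspondence

section TensorPow

variable (A : Type u) [CStarAlgebra A] [PartialOrder A] [StarOrderedRing A]
  (M : Type u) [NormedAddCommGroup M] [NormedSpace ℂ M] [Module Aᵐᵒᵖ M] [Module A M]
  [EssentialCorrespondence A M]

/-- The tensor powers `M^{⊗0} = A` and `M^{⊗(k+1)} = M ⊗_A M^{⊗k}`. -/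
noncomputable def tensorPowBundled : ℕ → BundledCorrespondence A
  | 0 => ⟨A⟩
  | k + 1 => ⟨InternalTensor A M (tensorPowBundled k).carrier⟩

/-- The space of the correspondence `M^{⊗k}`. -/
abbrev TensorPow (k : ℕ) : Type u := (tensorPowBundled A M k).carrier

variable {M}

/-- The element `m ⊗ x` of `M^{⊗(k+1)}`, for `m` in `M` and `x` in `M^{⊗k}`. -/
noncomputable def tensorCons {k : ℕ} (m : M) (x : TensorPow A M k) : TensorPow A M (k + 1) :=
  InternalTensor.tmul A m x

theorem ip_tensorCons {k : ℕ} (m n : M) (x y : TensorPow A M k) :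
    ip A (tensorCons A m x) (tensorCons A n y) = ip A (ip A n m • x) y :=
  InternalTensor.ip_tmul_tmul A m n x y

/-- The element `m (j 0) ⊗ ⋯ ⊗ m (j (k - 1))` of `M^{⊗k}`, which is `1` in `M^{⊗0} = A` if `k = 0`
(and the element `m (j 0) ⊗ 1` of `M ⊗_A A ≅ M` if `k = 1`). -/
noncomputable def tensorWord {J : Type w} (m : J → M) :
    (k : ℕ) → (Fin k → J) → TensorPow A M k
  | 0, _ => (1 : A)
  | k + 1, j => tensorCons A (m (j 0)) (tensorWord m k (Fin.tail j))

end TensorPow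

/-- Inner-product preserving maps of Hilbert modules. (Linearity over `ℂ` and `A` is automatic.) -/
structure IsometricMap (A : Type u) (E : Type v) (F : Type w) [CStarAlgebra A] [PartialOrder A]
    [NormedAddCommGroup E] [NormedSpace ℂ E] [Module Aᵐᵒᵖ E] [HilbertModule A E]
    [NormedAddCommGroup F] [NormedSpace ℂ F] [Module Aᵐᵒᵖ F] [HilbertModule A F] where
  toFun : E → F
  ip_map' (x y : E) : ip A (toFun x) (toFun y) = ip A x y

namespace IsometricMap

section

variable {A : Type u} {E : Type v} {F : Type w} [CStarAlgebra A] [PartialOrder A]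
    [NormedAddCommGroup E] [NormedSpace ℂ E] [Module Aᵐᵒᵖ E] [HilbertModule A E]
    [NormedAddCommGroup F] [NormedSpace ℂ F] [Module Aᵐᵒᵖ F] [HilbertModule A F]

instance : FunLike (IsometricMap A E F) E F where
  coe := toFun
  coe_injective f g h := by cases f; cases g; congr

theorem ip_map (T : IsometricMap A E F) (x y : E) : ip A (T x) (T y) = ip A x y :=
  T.ip_map' x y

variable [StarOrderedRing A]

theorem eq_zero_of_ip_self {x : F} (h : ip A x x = 0) : x = 0 := by
  have h1 : ‖x‖ ^ 2 = 0 := by rw [HilbertModule.norm_sq_eq (A := A), h, norm_zero]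
  exact norm_eq_zero.mp (pow_eq_zero_iff two_ne_zero |>.mp h1)

instance : LinearMapClass (IsometricMap A E F) ℂ E F where
  map_add T x y := by
    refine sub_eq_zero.mp (eq_zero_of_ip_self (A := A) ?_)
    simp only [ip_sub_left, ip_sub_right, ip_add_left, ip_add_right, ip_map]
    abel
  map_smulₛₗ T c x := by
    refine sub_eq_zero.mp (eq_zero_of_ip_self (A := A) ?_)
    simp only [ip_sub_left, ip_sub_right, ip_smul_left', ip_smul_right, ip_map, RingHom.id_apply,
      sub_self, smul_zero, smul_comm c (star c)]

instance : LinearMapClass (IsometricMap A E F) Aᵐᵒᵖ E F where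
  map_add := map_add
  map_smulₛₗ T c x := by
    obtain ⟨a, rfl⟩ := op_surjective c
    refine sub_eq_zero.mp (eq_zero_of_ip_self (A := A) ?_)
    simp only [ip_sub_left, ip_sub_right, ip_op_smul_left, ip_op_smul_right, ip_map,
      RingHom.id_apply, mul_assoc, sub_self, zero_mul]

end

end IsometricMap

/-- The map `T_k n = m₀ ⊗ n` from `M^{⊗k}` to `M^{⊗(k+1)}` given by a vector with
`⟨m₀, m₀⟩ = 1`. -/
noncomputable def tensorMap (A : Type u) [CStarAlgebra A] [PartialOrder A] [StarOrderedRing A]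
    {M : Type u} [NormedAddCommGroup M] [NormedSpace ℂ M] [Module Aᵐᵒᵖ M] [Module A M]
    [EssentialCorrespondence A M] (m₀ : M) (h₀ : ip A m₀ m₀ = 1) (k : ℕ) :
    IsometricMap A (TensorPow A M k) (TensorPow A M (k + 1)) where
  toFun n := tensorCons A m₀ n
  ip_map' x y := by rw [ip_tensorCons, h₀, one_smul]

namespace HilbertLimit

variable {A : Type u} [CStarAlgebra A] [PartialOrder A] [StarOrderedRing A]
  {X : ℕ → Type v} [∀ k, NormedAddCommGroup (X k)] [∀ k, NormedSpace ℂ (X k)]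
  [∀ k, Module Aᵐᵒᵖ (X k)] [∀ k, HilbertModule A (X k)]
  (T : ∀ k, IsometricMap A (X k) (X (k + 1)))

/-- The composition `X i → X (i + 1) → ⋯ → X j` of the maps `T`. -/
def transition (i j : ℕ) (h : i ≤ j) : IsometricMap A (X i) (X j) :=
  Nat.leRec (motive := fun j _ => IsometricMap A (X i) (X j))
    ⟨fun x => x, fun _ _ => rfl⟩
    (fun k _ S => ⟨fun x => T k (S x), fun x y => by rw [IsometricMap.ip_map, S.ip_map]⟩) h

theorem transition_self (i : ℕ) (x : X i) : transition T i i le_rfl x = x := by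
  rw [transition, Nat.leRec_self]
  rfl

theorem transition_succ (i j : ℕ) (h : i ≤ j) (x : X i) :
    transition T i (j + 1) (h.trans j.le_succ) x = T j (transition T i j h x) := by
  rw [transition, Nat.leRec_succ _ _ h]
  rfl

instance : DirectedSystem X (transition T · · ·) where
  map_self i x := transition_self T i x
  map_map k j i hij hjk x := by
    induction k, hjk using Nat.le_induction with
    | base => exact transition_self T j _
    | succ k hjk ih =>
      rw [transition_succ T j k hjk, transition_succ T i k (hij.trans hjk)]
      exact congrArg (T k) ih

/-- The quotient of the disjoint union of the `X k` which identifies `x` with `T k x`. -/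
def Alg : Type v := DirectLimit X (transition T)

noncomputable instance : AddCommGroup (Alg T) :=
  inferInstanceAs (AddCommGroup (DirectLimit X (transition T)))

noncomputable instance : Module ℂ (Alg T) :=
  inferInstanceAs (Module ℂ (DirectLimit X (transition T)))

noncomputable instance : Module Aᵐᵒᵖ (Alg T) :=
  inferInstanceAs (Module Aᵐᵒᵖ (DirectLimit X (transition T)))

/-- The class of `x` in `X k`. -/
def Alg.mk (k : ℕ) (x : X k) : Alg T := (⟦⟨k, x⟩⟧ : DirectLimit X (transition T))

/-- The inner product `⟨[x], [y]⟩ = ⟨x, y⟩` for `x` and `y` in the same `X k`. -/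
noncomputable def Alg.ip (z w : Alg T) : A :=
  DirectLimit.lift₂ (transition T) (transition T) (fun _ x y => PreHilbertModule.ip A x y)
    (fun i j h x y => ((transition T i j h).ip_map x y).symm) z w

theorem Alg.ip_mk_mk (k : ℕ) (x y : X k) :
    Alg.ip T (Alg.mk T k x) (Alg.mk T k y) = PreHilbertModule.ip A x y :=
  DirectLimit.lift₂_def ..

theorem Alg.exists_mk (z : Alg T) : ∃ k x, z = Alg.mk T k x :=
  DirectLimit.exists_eq_mk (transition T) z

theorem Alg.exists_mk₂ (z w : Alg T) : ∃ k x y, z = Alg.mk T k x ∧ w = Alg.mk T k y :=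
  DirectLimit.exists_eq_mk₂ (transition T) z w

theorem Alg.exists_mk₃ (z w t : Alg T) :
    ∃ k x y s, z = Alg.mk T k x ∧ w = Alg.mk T k y ∧ t = Alg.mk T k s :=
  DirectLimit.exists_eq_mk₃ (transition T) z w t

theorem Alg.mk_add (k : ℕ) (x y : X k) : Alg.mk T k (x + y) = Alg.mk T k x + Alg.mk T k y :=
  (DirectLimit.add_def (f := transition T) k x y).symm

theorem Alg.mk_smul (k : ℕ) (c : ℂ) (x : X k) : Alg.mk T k (c • x) = c • Alg.mk T k x := rfl

theorem Alg.mk_op_smul (k : ℕ) (c : Aᵐᵒᵖ) (x : X k) : Alg.mk T k (c • x) = c • Alg.mk T k x :=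
  rfl

theorem Alg.mk_map (k : ℕ) (x : X k) : Alg.mk T (k + 1) (T k x) = Alg.mk T k x := by
  have h := DirectLimit.mk_apply (f := transition T) k (k + 1) x k.le_succ
  have h1 := transition_succ T k k le_rfl x
  rw [transition_self] at h1
  rw [← h1]
  exact h

noncomputable instance : PreHilbertModule A (Alg T) where
  ip := Alg.ip T
  ip_add_right z w t := by
    obtain ⟨k, x, y, s, rfl, rfl, rfl⟩ := Alg.exists_mk₃ T z w t
    rw [← Alg.mk_add, Alg.ip_mk_mk, Alg.ip_mk_mk, Alg.ip_mk_mk, ip_add_right]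
  ip_smul_right c z w := by
    obtain ⟨k, x, y, rfl, rfl⟩ := Alg.exists_mk₂ T z w
    rw [← Alg.mk_smul, Alg.ip_mk_mk, Alg.ip_mk_mk, ip_smul_right]
  ip_op_smul_right a z w := by
    obtain ⟨k, x, y, rfl, rfl⟩ := Alg.exists_mk₂ T z w
    rw [← Alg.mk_op_smul, Alg.ip_mk_mk, Alg.ip_mk_mk, ip_op_smul_right]
  star_ip z w := by
    obtain ⟨k, x, y, rfl, rfl⟩ := Alg.exists_mk₂ T z w
    rw [Alg.ip_mk_mk, Alg.ip_mk_mk, star_ip]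
  ip_self_nonneg z := by
    obtain ⟨k, x, rfl⟩ := Alg.exists_mk T z
    rw [Alg.ip_mk_mk]
    exact ip_self_nonneg x

end HilbertLimit

/-- The direct limit of a sequence of Hilbert modules and inner-product preserving maps: the
completion of the quotient of the disjoint union of the `X k` which identifies `x` with `T k x`. -/
abbrev HilbertLimit {A : Type u} [CStarAlgebra A] [PartialOrder A] [StarOrderedRing A]
    {X : ℕ → Type v} [∀ k, NormedAddCommGroup (X k)] [∀ k, NormedSpace ℂ (X k)]
    [∀ k, Module Aᵐᵒᵖ (X k)] [∀ k, HilbertModule A (X k)]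
    (T : ∀ k, IsometricMap A (X k) (X (k + 1))) : Type v :=
  HilbertCompletion A (HilbertLimit.Alg T)

/-- The canonical maps `ι^k` from `X k` to the direct limit. -/
noncomputable def HilbertLimit.ι {A : Type u} [CStarAlgebra A] [PartialOrder A] [StarOrderedRing A]
    {X : ℕ → Type v} [∀ k, NormedAddCommGroup (X k)] [∀ k, NormedSpace ℂ (X k)]
    [∀ k, Module Aᵐᵒᵖ (X k)] [∀ k, HilbertModule A (X k)]
    (T : ∀ k, IsometricMap A (X k) (X (k + 1))) (k : ℕ) : IsometricMap A (X k) (HilbertLimit T) where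
  toFun x := toCompletion A (HilbertLimit.Alg.mk T k x)
  ip_map' x y := by
    rw [ip_toCompletion]
    exact HilbertLimit.Alg.ip_mk_mk T k x y

theorem HilbertLimit.ι_map {A : Type u} [CStarAlgebra A] [PartialOrder A] [StarOrderedRing A]
    {X : ℕ → Type v} [∀ k, NormedAddCommGroup (X k)] [∀ k, NormedSpace ℂ (X k)]
    [∀ k, Module Aᵐᵒᵖ (X k)] [∀ k, HilbertModule A (X k)]
    (T : ∀ k, IsometricMap A (X k) (X (k + 1))) (k : ℕ) (x : X k) :
    HilbertLimit.ι T (k + 1) (T k x) = HilbertLimit.ι T k x :=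
  congrArg (toCompletion A) (HilbertLimit.Alg.mk_map T k x)

section Frames

variable (A : Type u) {E : Type v} [CStarAlgebra A] [PartialOrder A]
  [NormedAddCommGroup E] [NormedSpace ℂ E] [Module Aᵐᵒᵖ E] [HilbertModule A E]

/-- The family `x` is a Parseval frame: `⟨z, z⟩ = ∑ j, ⟨z, x j⟩ ⟨x j, z⟩` for every `z`, with
convergence in norm of the net of finite partial sums. -/
def IsParsevalFrame {J : Type w} (x : J → E) : Prop :=
  ∀ z : E, HasSum (fun j => ip A z (x j) * ip A (x j) z) (ip A z z)

/-- The family `x` is an orthonormal basis: `⟨x i, x j⟩` is `1` for `i = j` and `0` otherwise, and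
the `x j` generate the Hilbert module, i.e. the `A`-linear combinations of them are dense. -/
def IsOrthonormalBasis {J : Type w} (x : J → E) : Prop :=
  (∀ i, ip A (x i) (x i) = 1) ∧ (∀ i j, i ≠ j → ip A (x i) (x j) = 0) ∧
    Dense (Submodule.span Aᵐᵒᵖ (Set.range x) : Set E)

end Frames

section Main

variable (A : Type u) [CStarAlgebra A] [PartialOrder A] [StarOrderedRing A]
  {M : Type u} [NormedAddCommGroup M] [NormedSpace ℂ M] [Module Aᵐᵒᵖ M] [Module A M]
  [EssentialCorrespondence A M]

/-- The direct limit `M_∞` of the tensor powers `M^{⊗k}` along the maps `T_k n = m₀ ⊗ n`. -/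
abbrev MInfty (m₀ : M) (h₀ : ip A m₀ m₀ = 1) : Type u :=
  HilbertLimit (tensorMap A m₀ h₀)

/-- The family consisting of `ι^0(1)` and of the vectors `ι^k(m (j 1) ⊗ ⋯ ⊗ m (j k))` with `k ≥ 1`
and `j 1 ≠ j₀`. (Here `k` is written as `k + 1`, and the indices start from `0`.) -/
noncomputable def limitFamily {J : Type w} (m : J → M) (j₀ : J) (h₀ : ip A (m j₀) (m j₀) = 1) :
    Option (Σ k : ℕ, {j : Fin (k + 1) → J // j 0 ≠ j₀}) → MInfty A (m j₀) h₀
  | none => HilbertLimit.ι (tensorMap A (m j₀) h₀) 0 (1 : A)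
  | some ⟨k, j⟩ => HilbertLimit.ι (tensorMap A (m j₀) h₀) (k + 1) (tensorWord A m (k + 1) j)

end Main

/-! The maps `T_k` only prepend `m j₀`, so in the limit a word `m_{j_1} ⊗ ⋯ ⊗ m_{j_k}` depends only
on what remains after its leading letters `j₀` are dropped (`ι_tensorWord`). For fixed `k` this
reduction is injective, and its image consists of the members of the family of length at most `k`. A
longer member starts, at its own level, with some `m j`, `j ≠ j₀`, whereas a vector coming from
`M^{⊗k}` can be written there as `m j₀ ⊗ w`. The Parseval identity at `m j₀` together with `⟨m j₀, m
j₀⟩ = 1` forces `m j ⊥ m j₀`, so the two are orthogonal (`ip_ι_limitFamily_eq_zero`). Hence on the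
image of `M^{⊗k}` the Parseval identity for the family is the one for words of length `k`.

Words form a Parseval frame of `M^{⊗k}` by induction on `k`, because the tensors `m_j ⊗ x_i` of two
Parseval frames form a Parseval frame: with `m_j^* (n ⊗ y) = ⟨m_j, n⟩ • y`, one has `⟨z, z⟩ = ∑ j,
⟨m_j^* z, m_j^* z⟩`, and each term is expanded in the second frame.

These identities are proved on dense subspaces. They extend to completions
(`isParsevalFrame_completion`) because the Parseval defect of a finite set is a positive quadratic
form dominated by `⟨z, z⟩`.

For an orthonormal basis, inner products of two members are computed in a common `M^{⊗k}`; density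
of the span follows from orthonormality and the Parseval identity. -/

/-! ### Sums of positive elements in a C⋆-algebra -/

theorem hasSum_iff_exists_norm_sub_lt {A : Type u} {ι : Type w} [NormedAddCommGroup A] {f : ι → A}
    {c : A} : HasSum f c ↔
      ∀ ε : ℝ, 0 < ε → ∃ s : Finset ι, ∀ t, s ⊆ t → ‖c - ∑ i ∈ t, f i‖ < ε := by
  classical
  rw [HasSum, SummationFilter.unconditional_filter, Metric.tendsto_atTop]
  simp only [dist_comm _ c, dist_eq_norm]

/-- The norm is monotone on positive elements and the defect `c - ∑ i ∈ t, f i` decreases as `t`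
grows, so one good finite set controls all larger ones. -/
theorem hasSum_of_nonneg_of_exists_norm_sub_lt {A : Type u} {ι : Type w} [CStarAlgebra A]
    [PartialOrder A] [StarOrderedRing A] {f : ι → A} {c : A} (hf : ∀ i, 0 ≤ f i)
    (hle : ∀ s : Finset ι, ∑ i ∈ s, f i ≤ c)
    (hc : ∀ ε : ℝ, 0 < ε → ∃ s : Finset ι, ‖c - ∑ i ∈ s, f i‖ < ε) : HasSum f c := by
  refine hasSum_iff_exists_norm_sub_lt.mpr fun ε hε => ?_
  obtain ⟨s, hs⟩ := hc ε hε
  refine ⟨s, fun t hst => ?_⟩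
  refine (CStarAlgebra.norm_le_norm_of_nonneg_of_le (sub_nonneg.mpr (hle t)) ?_).trans_lt hs
  exact sub_le_sub_left (Finset.sum_le_sum_of_subset_of_nonneg hst fun i _ _ => hf i) c

theorem sum_le_of_hasSum_of_nonneg {A : Type u} {ι : Type w} [CStarAlgebra A]
    [PartialOrder A] [StarOrderedRing A] {f : ι → A} {c : A} (hf : ∀ i, 0 ≤ f i)
    (h : HasSum f c) (s : Finset ι) : ∑ i ∈ s, f i ≤ c := by
  rw [HasSum, SummationFilter.unconditional_filter] at h
  refine sub_nonneg.mp (CStarAlgebra.isClosed_nonneg.mem_of_tendsto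
    (h.sub_const (∑ i ∈ s, f i)) ?_)
  filter_upwards [Filter.eventually_ge_atTop s] with t hst
  exact sub_nonneg.mpr (Finset.sum_le_sum_of_subset_of_nonneg hst fun i _ _ => hf i)

/-- Positivity turns an iterated sum into an unconditional sum over pairs: every finite set of pairs
lies in a rectangle, whose sum is at most `c`, and rectangles already approximate `c`. -/
theorem hasSum_prod_of_nonneg {A : Type u} {ι : Type v} {κ : Type w} [CStarAlgebra A]
    [PartialOrder A] [StarOrderedRing A] {f : ι × κ → A} {g : ι → A} {c : A}
    (hf : ∀ p, 0 ≤ f p) (hg : ∀ i, HasSum (fun j => f (i, j)) (g i)) (hc : HasSum g c) :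
    HasSum f c := by
  classical
  have hg0 : ∀ i, 0 ≤ g i := fun i => by
    simpa using sum_le_of_hasSum_of_nonneg (fun j => hf (i, j)) (hg i) ∅
  refine hasSum_of_nonneg_of_exists_norm_sub_lt hf (fun s => ?_) fun ε hε => ?_
  · calc ∑ p ∈ s, f p ≤ ∑ p ∈ s.image Prod.fst ×ˢ s.image Prod.snd, f p :=
          Finset.sum_le_sum_of_subset_of_nonneg (Finset.subset_product) fun p _ _ => hf p
      _ = ∑ i ∈ s.image Prod.fst, ∑ j ∈ s.image Prod.snd, f (i, j) := Finset.sum_product _ _ _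
      _ ≤ ∑ i ∈ s.image Prod.fst, g i := Finset.sum_le_sum fun i _ =>
          sum_le_of_hasSum_of_nonneg (fun j => hf (i, j)) (hg i) _
      _ ≤ c := sum_le_of_hasSum_of_nonneg hg0 hc _
  · obtain ⟨s, hs⟩ := hasSum_iff_exists_norm_sub_lt.mp hc (ε / 2) (half_pos hε)
    have h1 : HasSum (fun j => ∑ i ∈ s, f (i, j)) (∑ i ∈ s, g i) := hasSum_sum fun i _ => hg i
    obtain ⟨t, ht⟩ := hasSum_iff_exists_norm_sub_lt.mp h1 (ε / 2) (half_pos hε)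
    refine ⟨s ×ˢ t, ?_⟩
    have h2 := hs s le_rfl
    have h3 := ht t le_rfl
    rw [← Finset.sum_product_right] at h3
    linarith [norm_sub_le_norm_sub_add_norm_sub c (∑ i ∈ s, g i) (∑ p ∈ s ×ˢ t, f p)]

/-! ### Parseval frames in Hilbert modules -/

section ParsevalFrames

variable {A : Type u} [CStarAlgebra A] [PartialOrder A] [StarOrderedRing A]

theorem ip_mul_ip_nonneg {E : Type v} [AddCommGroup E] [Module ℂ E] [Module Aᵐᵒᵖ E]
    [PreHilbertModule A E] (x z : E) : 0 ≤ ip A z x * ip A x z := by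
  rw [← star_ip]
  exact star_mul_self_nonneg _

/-- The defect `Q` is the diagonal of a sesquilinear form. When `Q` is also positive, dropping `Q (y
- z)` leaves `Q (y + z) ≤ 2 • Q y + 2 • Q z`, a substitute for the triangle inequality. -/
theorem frameDefect_parallelogram {E : Type v} {J : Type w} [AddCommGroup E] [Module ℂ E]
    [Module Aᵐᵒᵖ E] [PreHilbertModule A E] (x : J → E) (s : Finset J) {Q : E → A}
    (hQ : ∀ z, Q z = ip A z z - ∑ j ∈ s, ip A z (x j) * ip A (x j) z) (y z : E) :
    Q (y + z) + Q (y - z) = 2 • Q y + 2 • Q z := by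
  simp only [hQ, ip_add_left, ip_add_right, ip_sub_left, ip_sub_right, smul_sub, Finset.smul_sum]
  rw [sub_add_sub_comm, sub_add_sub_comm, ← Finset.sum_add_distrib, ← Finset.sum_add_distrib]
  congr 1
  · abel
  · exact Finset.sum_congr rfl fun j _ => by noncomm_ring

/-- For a fixed finite set the defect `Q` is continuous, so its positivity passes to the completion.
For `z` near a vector `y` of the dense image, `Q z ≤ 2 • Q y + 2 • Q (z - y)`; the first term is
small by the Parseval identity at `y`, the second because `Q (z - y) ≤ ⟨z - y, z - y⟩`. -/
theorem isParsevalFrame_completion {E : Type v} {J : Type w} [AddCommGroup E] [Module ℂ E]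
    [Module Aᵐᵒᵖ E] [PreHilbertModule A E] {x : J → HilbertCompletion A E}
    (h : ∀ z : E, HasSum (fun j => ip A (toCompletion A z) (x j) * ip A (x j) (toCompletion A z))
      (ip A z z)) : IsParsevalFrame A x := by
  have hle : ∀ (s : Finset J) (z : HilbertCompletion A E),
      0 ≤ ip A z z - ∑ j ∈ s, ip A z (x j) * ip A (x j) z := fun s z => by
    refine (denseRange_toCompletion A E).induction_on
      (p := fun z => 0 ≤ completionIp A z z -
        ∑ j ∈ s, completionIp A z (x j) * completionIp A (x j) z) z
      (CStarAlgebra.isClosed_nonneg.preimage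
        ((continuous_completionIp_comp A continuous_id continuous_id).sub
          (continuous_finsetSum _ fun j _ =>
            (continuous_completionIp_comp A continuous_id continuous_const).mul
              (continuous_completionIp_comp A continuous_const continuous_id)))) fun z => ?_
    rw [completionIp_coe, sub_nonneg]
    exact sum_le_of_hasSum_of_nonneg (fun j => ip_mul_ip_nonneg _ _) (h z) s
  intro z
  refine hasSum_of_nonneg_of_exists_norm_sub_lt (fun j => ip_mul_ip_nonneg _ _)
    (fun s => sub_nonneg.mp (hle s z)) fun ε hε => ?_
  -- With `‖z - y‖ ^ 2 < ε / 4` and `‖Q y‖ < ε / 4`, the bound `2 * ‖Q y‖ + 2 * ‖Q (z - y)‖` stays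
  -- below `ε`.
  obtain ⟨d, hd⟩ := (denseRange_toCompletion A E).exists_dist_lt z
    (ε := √(ε / 4)) (Real.sqrt_pos.mpr (by positivity))
  obtain ⟨s, hs⟩ := hasSum_iff_exists_norm_sub_lt.mp (h d) (ε / 4) (by positivity)
  have hs := hs s le_rfl
  rw [← ip_toCompletion A E] at hs
  rw [dist_eq_norm] at hd
  refine ⟨s, ?_⟩
  set y := toCompletion A d
  let Q : HilbertCompletion A E → A := fun z =>
    ip A z z - ∑ j ∈ s, ip A z (x j) * ip A (x j) z
  have h1 := frameDefect_parallelogram x s (Q := Q) (fun z => rfl) y (z - y)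
  rw [add_sub_cancel] at h1
  have h2 : Q z ≤ 2 • Q y + 2 • Q (z - y) := by
    rw [← h1]
    exact le_add_of_nonneg_right (hle s _)
  have h3 : ‖Q (z - y)‖ ≤ ‖z - y‖ ^ 2 := by
    rw [HilbertModule.norm_sq_eq (A := A)]
    exact CStarAlgebra.norm_le_norm_of_nonneg_of_le (hle s _)
      (sub_le_self _ (Finset.sum_nonneg fun j _ => ip_mul_ip_nonneg _ _))
  have h4 : ‖z - y‖ ^ 2 < ε / 4 := by
    rw [← Real.sq_sqrt (show 0 ≤ ε / 4 by positivity)]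
    exact pow_lt_pow_left₀ hd (norm_nonneg _) two_ne_zero
  change ‖Q z‖ < ε
  have h5 : ‖Q z‖ ≤ ‖2 • Q y + 2 • Q (z - y)‖ :=
    CStarAlgebra.norm_le_norm_of_nonneg_of_le (hle s z) h2
  have h6 : ‖2 • Q y + 2 • Q (z - y)‖ ≤ 2 * ‖Q y‖ + 2 * ‖Q (z - y)‖ := by
    simp only [two_nsmul, two_mul]
    exact (norm_add_le _ _).trans (add_le_add (norm_add_le _ _) (norm_add_le _ _))
  have h7 : ‖Q y‖ < ε / 4 := hs
  linarith

variable {E : Type v} [NormedAddCommGroup E] [NormedSpace ℂ E] [Module Aᵐᵒᵖ E] [HilbertModule A E]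

theorem IsParsevalFrame.hasSum_ip {J : Type w} {x : J → E} (hx : IsParsevalFrame A x) (y z : E) :
    HasSum (fun j => ip A y (x j) * ip A (x j) z) (ip A y z) := by
  -- Polarization for a form conjugate-linear in the first variable, applied below both to the inner
  -- product and to each summand. Differences are written as `y + c • z` so that additivity and
  -- homogeneity suffice to expand it.
  have key : ∀ B : E → E → A, (∀ x y z, B (x + y) z = B x z + B y z) →
      (∀ x y z, B x (y + z) = B x y + B x z) → (∀ (c : ℂ) x y, B (c • x) y = star c • B x y) →
      (∀ (c : ℂ) x y, B x (c • y) = c • B x y) →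
      B y z = (4⁻¹ : ℂ) • (B (y + z) (y + z) + (-1 : ℂ) • B (y + (-1 : ℂ) • z) (y + (-1 : ℂ) • z) +
        (-Complex.I) • B (y + Complex.I • z) (y + Complex.I • z) +
        Complex.I • B (y + (-Complex.I) • z) (y + (-Complex.I) • z)) := fun B h1 h2 h3 h4 => by
    simp only [h1, h2, h3, h4]
    match_scalars <;> norm_num
  have h := ((((hx (y + z)).add ((hx (y + (-1 : ℂ) • z)).const_smul (-1 : ℂ))).add
    ((hx (y + Complex.I • z)).const_smul (-Complex.I))).add
    ((hx (y + (-Complex.I) • z)).const_smul Complex.I)).const_smul (4⁻¹ : ℂ)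
  rw [← key (fun y z => ip A y z) (ip_add_left A) ip_add_right (ip_smul_left' A) ip_smul_right] at h
  refine h.congr_fun fun j => ?_
  exact key (fun y z => ip A y (x j) * ip A (x j) z)
    (fun _ _ _ => by rw [ip_add_left, add_mul]) (fun _ _ _ => by rw [ip_add_right, mul_add])
    (fun _ _ _ => by rw [ip_smul_left', smul_mul_assoc])
    (fun _ _ _ => by rw [ip_smul_right, mul_smul_comm])

/-- In the Parseval identity at `x i` the term of index `i` alone already equals `⟨x i, x i⟩ = 1`,
so every other term, being positive, vanishes. -/
theorem IsParsevalFrame.ip_eq_zero {J : Type w} {x : J → E} (hx : IsParsevalFrame A x)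
    {i j : J} (hi : ip A (x i) (x i) = 1) (hij : j ≠ i) : ip A (x j) (x i) = 0 := by
  classical
  have h := sum_le_of_hasSum_of_nonneg (fun _ => ip_mul_ip_nonneg _ _) (hx (x i)) {i, j}
  rw [Finset.sum_pair hij.symm, hi, mul_one, ← star_ip (x j), add_le_iff_nonpos_right] at h
  exact (CStarRing.star_mul_self_eq_zero_iff _).mp (le_antisymm h (star_mul_self_nonneg _))

/-- By orthonormality, the squared distance from `z` to the partial expansion `∑ j ∈ s, x j · ⟨x j,
z⟩` is the norm of the Parseval defect, which tends to zero. -/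
theorem IsParsevalFrame.dense_span {J : Type w} {x : J → E} (hx : IsParsevalFrame A x)
    (h1 : ∀ i, ip A (x i) (x i) = 1) (h0 : ∀ i j, i ≠ j → ip A (x i) (x j) = 0) :
    Dense (Submodule.span Aᵐᵒᵖ (Set.range x) : Set E) := by
  classical
  intro z
  refine Metric.mem_closure_iff.mpr fun ε hε => ?_
  obtain ⟨s, hs⟩ := hasSum_iff_exists_norm_sub_lt.mp (hx z) (ε ^ 2) (by positivity)
  refine ⟨∑ j ∈ s, op (ip A (x j) z) • x j, Submodule.sum_mem _ fun j _ =>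
    Submodule.smul_mem _ _ (Submodule.subset_span ⟨j, rfl⟩), ?_⟩
  have hs := hs s le_rfl
  rw [dist_eq_norm]
  refine lt_of_pow_lt_pow_left₀ 2 hε.le ?_
  rw [HilbertModule.norm_sq_eq (A := A)]
  have hd : ∀ i ∈ s, ∑ j ∈ s, ip A z (x j) * ip A (x j) (x i) = ip A z (x i) := fun i hi => by
    rw [Finset.sum_eq_single_of_mem i hi fun j _ hj => by rw [h0 j i hj, mul_zero], h1, mul_one]
  refine (congrArg norm ?_).trans_lt hs
  simp only [ip_sub_left, ip_sub_right, ip_sum_left (A := A), ip_sum_right (A := A),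
    ip_op_smul_left, ip_op_smul_right, star_ip]
  rw [sub_eq_self]
  exact Finset.sum_eq_zero fun i hi => by rw [hd i hi, sub_self, zero_mul]

end ParsevalFrames

/-! ### Parseval frames of internal tensor products -/

section TensorFrames

variable {A : Type u} [CStarAlgebra A] [PartialOrder A] [StarOrderedRing A]

namespace InternalTensor

variable {M : Type v} {X : Type w} [NormedAddCommGroup M] [NormedSpace ℂ M] [Module Aᵐᵒᵖ M]
  [HilbertModule A M] [NormedAddCommGroup X] [NormedSpace ℂ X] [Module Aᵐᵒᵖ X] [Module A X]
  [EssentialCorrespondence A X]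

/-- The adjoint `n ⊗ y ↦ ⟨m, n⟩ • y` of `x ↦ m ⊗ x`, on the algebraic tensor product. -/
noncomputable def contract (m : M) : M ⊗[ℂ] X →ₗ[ℂ] X :=
  TensorProduct.lift (LinearMap.mk₂ ℂ (fun (n : M) (y : X) => ip A m n • y)
    (fun n n' y => by rw [ip_add_right, add_smul])
    (fun c n y => by rw [ip_smul_right, PreCorrespondence.smul_assoc_left])
    (fun n y y' => smul_add _ _ _)
    (fun c n y => PreCorrespondence.smul_comm_left _ _ _))

theorem form_tmul_right (m : M) (x : X) (z : M ⊗[ℂ] X) :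
    form A M X z (m ⊗ₜ x) = ip A (contract (A := A) m z) x := by
  induction z using TensorProduct.induction_on with
  | zero => rw [map_zero, map_zero, LinearMap.zero_apply, ip_zero_left]
  | add w w' h h' => rw [map_add, map_add, LinearMap.add_apply, h, h', ip_add_left]
  | tmul n y => rfl

/-- On elementary tensors `z = l ⊗ x`, `w = n ⊗ y` this is the polarized identity `⟨n, l⟩ = ∑ j, ⟨n,
m j⟩ ⟨m j, l⟩` pushed through the continuous map `a ↦ ⟨a • x, y⟩`. Two independent arguments are
needed to reduce to elementary tensors by additivity. -/
theorem hasSum_ip_contract {J : Type*} {m : J → M} (hm : IsParsevalFrame A m) (z w : M ⊗[ℂ] X) :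
    HasSum (fun j => ip A (contract (A := A) (m j) z) (contract (A := A) (m j) w))
      (form A M X z w) := by
  induction w using TensorProduct.induction_on with
  | zero => simpa only [map_zero, ip_zero_right] using hasSum_zero
  | add w w' h h' => simpa only [map_add, ip_add_right] using h.add h'
  | tmul n y =>
    induction z using TensorProduct.induction_on with
    | zero => simpa only [map_zero, ip_zero_left, LinearMap.zero_apply] using hasSum_zero
    | add w w' h h' => simpa only [map_add, ip_add_left, LinearMap.add_apply] using h.add h'
    | tmul l x =>
      have h1 := hm.hasSum_ip n l
      let φ : A →ₗ⋆[ℂ] A :=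
        { toFun := fun a => ip A (a • x) y
          map_add' := fun a b => by rw [add_smul, ip_add_left]
          map_smul' := fun c a => ip_left_smul_smul A X c a x y }
      have hφ : ∀ a, ‖φ a‖ ≤ (‖x‖ * ‖y‖) * ‖a‖ := fun a => by
        refine abs_le_of_sq_le_sq' ?_ (by positivity) |>.2
        calc ‖ip A (a • x) y‖ ^ 2 ≤ ‖ip A (a • x) (a • x)‖ * ‖ip A y y‖ := norm_ip_sq_le A _ _
          _ ≤ ‖a‖ ^ 2 * ‖ip A x x‖ * ‖ip A y y‖ := by
            gcongr
            exact norm_ip_left_smul_le A a x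
          _ = (‖x‖ * ‖y‖ * ‖a‖) ^ 2 := by
            rw [← HilbertModule.norm_sq_eq, ← HilbertModule.norm_sq_eq]
            ring
      have h2 := h1.map φ (φ.mkContinuous _ hφ).continuous
      refine h2.congr_fun fun j => ?_
      change ip A (ip A (m j) l • x) (ip A (m j) n • y) =
        ip A ((ip A n (m j) * ip A (m j) l) • x) y
      rw [mul_smul, PreCorrespondence.ip_smul_left (ip A n (m j)), star_ip]

/-- For `z` in the algebraic tensor product and fixed `j`, the sum over `k` is the Parseval identity
of `x` at `contract (m j) z`; the sum over `j` is then `hasSum_ip_contract`. -/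
theorem isParsevalFrame_tmul {J K : Type*} {m : J → M} {x : K → X} (hm : IsParsevalFrame A m)
    (hx : IsParsevalFrame A x) :
    IsParsevalFrame A fun p : J × K => InternalTensor.tmul A (m p.1) (x p.2) := by
  refine isParsevalFrame_completion fun z => ?_
  refine hasSum_prod_of_nonneg (fun p => ip_mul_ip_nonneg _ _) (fun j => ?_)
    (hasSum_ip_contract hm z z)
  have h1 : ∀ k, ip A (toCompletion A z) (InternalTensor.tmul A (m j) (x k)) =
      ip A (contract (A := A) (m j) z) (x k) := fun k =>
    (ip_toCompletion A _ z _).trans (form_tmul_right (m j) (x k) z)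
  have h2 : ∀ k, ip A (InternalTensor.tmul A (m j) (x k)) (toCompletion A z) =
      ip A (x k) (contract (A := A) (m j) z) := fun k => by
    rw [← star_ip, h1, star_ip]
  simp only [h1, h2]
  exact hx _

end InternalTensor

end TensorFrames

/-! ### Words in the tensor powers -/

section TensorWords

variable {A : Type u} [CStarAlgebra A] [PartialOrder A] [StarOrderedRing A]
  {M : Type u} [NormedAddCommGroup M] [NormedSpace ℂ M] [Module Aᵐᵒᵖ M] [Module A M]
  [EssentialCorrespondence A M] {J : Type w} {m : J → M}

theorem isParsevalFrame_tensorWord (hm : IsParsevalFrame A m) (k : ℕ) :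
    IsParsevalFrame A (tensorWord A m k) := by
  induction k with
  | zero =>
    intro (z : A)
    have h : star z * 1 * (star 1 * z) = star z * z := by rw [star_one, mul_one, one_mul]
    change HasSum (fun _ : Fin 0 → J => star z * 1 * (star 1 * z)) (star z * z)
    rw [h]
    -- There is exactly one empty word, and the single vector `1` is a Parseval frame of `A`.
    exact hasSum_unique fun _ : Fin 0 → J => star z * z
  | succ k ih =>
    intro z
    -- A word of length `k + 1` is a pair of first letter and tail.
    exact (Fin.consEquiv fun _ : Fin (k + 1) => J).hasSum_iff.mp
      (InternalTensor.isParsevalFrame_tmul hm ih z)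

theorem ip_tensorWord_self (h1 : ∀ i, ip A (m i) (m i) = 1) (k : ℕ) (j : Fin k → J) :
    ip A (tensorWord A m k j) (tensorWord A m k j) = 1 := by
  induction k with
  | zero => exact (congrArg (· * (1 : A)) (star_one A)).trans (mul_one 1)
  | succ k ih =>
    refine (ip_tensorCons A _ _ _ _).trans ?_
    rw [h1, one_smul, ih]

theorem ip_tensorWord_of_ne (h1 : ∀ i, ip A (m i) (m i) = 1)
    (h0 : ∀ i j, i ≠ j → ip A (m i) (m j) = 0) (k : ℕ) (i j : Fin k → J) (hij : i ≠ j) :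
    ip A (tensorWord A m k i) (tensorWord A m k j) = 0 := by
  induction k with
  | zero => exact absurd (Subsingleton.elim i j) hij
  | succ k ih =>
    refine (ip_tensorCons A _ _ _ _).trans ?_
    by_cases h : i 0 = j 0
    · rw [h, h1, one_smul]
      refine ih _ _ fun h' => hij ?_
      rw [← Fin.cons_self_tail i, ← Fin.cons_self_tail j, h, h']
    · rw [h0 _ _ (Ne.symm h), zero_smul, ip_zero_left]

end TensorWords

/-! ### Reduced words and the direct limit -/

section LimitFrame

variable {A : Type u} [CStarAlgebra A] [PartialOrder A] [StarOrderedRing A]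
  {M : Type u} [NormedAddCommGroup M] [NormedSpace ℂ M] [Module Aᵐᵒᵖ M] [Module A M]
  [EssentialCorrespondence A M] {J : Type w}

open Classical in
/-- The index of the vector `ι^k(m (j 1) ⊗ ⋯ ⊗ m (j k))` of the direct limit in the family
`limitFamily`: all leading letters `j₀` are dropped. -/
noncomputable def reducedWord (j₀ : J) :
    (k : ℕ) → (Fin k → J) → Option (Σ k : ℕ, {j : Fin (k + 1) → J // j 0 ≠ j₀})
  | 0, _ => none
  | k + 1, j => if h : j 0 = j₀ then reducedWord j₀ k (Fin.tail j) else some ⟨k, j, h⟩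

theorem reducedWord_cons_self (j₀ : J) (k : ℕ) (j : Fin k → J) :
    reducedWord j₀ (k + 1) (Fin.cons j₀ j) = reducedWord j₀ k j := by
  rw [reducedWord, dif_pos (Fin.cons_zero _ _), Fin.tail_cons]

/-- The first component of an index is the length of the word minus one, so the strict inequality
says that reduction does not lengthen a word. It separates the two branches of `reducedWord` in the
proof of injectivity. -/
theorem lt_of_reducedWord_eq_some (j₀ : J) (k : ℕ) (j : Fin k → J)
    {p : Σ k : ℕ, {j : Fin (k + 1) → J // j 0 ≠ j₀}} (h : reducedWord j₀ k j = some p) :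
    p.1 < k := by
  induction k with
  | zero => exact absurd h (Option.some_ne_none p).symm
  | succ k ih =>
    rw [reducedWord] at h
    split_ifs at h with hj
    · exact (ih _ h).trans k.lt_succ_self
    · rw [← Option.some.inj h]
      exact k.lt_succ_self

/-- The length `k` determines how many letters `j₀` were dropped, so they can be restored. -/
theorem reducedWord_injective (j₀ : J) (k : ℕ) : Function.Injective (reducedWord j₀ k) := by
  induction k with
  | zero => exact fun i j _ => Subsingleton.elim i j
  | succ k ih =>
    intro i j h
    rw [reducedWord, reducedWord] at h
    split_ifs at h with hi hj hj
    · rw [← Fin.cons_self_tail i, ← Fin.cons_self_tail j, hi, hj, ih h]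
    · exact absurd (lt_of_reducedWord_eq_some j₀ k _ h) (lt_irrefl k)
    · exact absurd (lt_of_reducedWord_eq_some j₀ k _ h.symm) (lt_irrefl k)
    · simpa using h

theorem none_mem_range_reducedWord (j₀ : J) (k : ℕ) : none ∈ Set.range (reducedWord j₀ k) := by
  induction k with
  | zero => exact ⟨Fin.elim0, rfl⟩
  | succ k ih =>
    obtain ⟨j, hj⟩ := ih
    exact ⟨Fin.cons j₀ j, by rw [reducedWord_cons_self, hj]⟩

/-- Pad the word on the left with letters `j₀` up to length `k`. -/
theorem some_mem_range_reducedWord (j₀ : J) (p : Σ k : ℕ, {j : Fin (k + 1) → J // j 0 ≠ j₀})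
    {k : ℕ} (hk : p.1 < k) : some p ∈ Set.range (reducedWord j₀ k) := by
  induction k, hk using Nat.le_induction with
  | base => exact ⟨p.2.1, by rw [reducedWord, dif_neg p.2.2]⟩
  | succ k _ ih =>
    obtain ⟨j, hj⟩ := ih
    exact ⟨Fin.cons j₀ j, by rw [reducedWord_cons_self, hj]⟩

/-- Provides one tensor power in which the inner product of two members of the family can be
computed. -/
theorem exists_mem_range_reducedWord (j₀ : J)
    (p q : Option (Σ k : ℕ, {j : Fin (k + 1) → J // j 0 ≠ j₀})) :
    ∃ k, p ∈ Set.range (reducedWord j₀ k) ∧ q ∈ Set.range (reducedWord j₀ k) := by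
  have h : ∀ p : Option (Σ k : ℕ, {j : Fin (k + 1) → J // j 0 ≠ j₀}),
      ∃ n, ∀ k, n ≤ k → p ∈ Set.range (reducedWord j₀ k)
    | none => ⟨0, fun k _ => none_mem_range_reducedWord j₀ k⟩
    | some p => ⟨p.1 + 1, fun k hk => some_mem_range_reducedWord j₀ p hk⟩
  obtain ⟨a, ha⟩ := h p
  obtain ⟨b, hb⟩ := h q
  exact ⟨max a b, ha _ (le_max_left a b), hb _ (le_max_right a b)⟩

variable {m : J → M} {j₀ : J} (h₀ : ip A (m j₀) (m j₀) = 1)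

/-- A leading `m j₀` is an application of `T_k`, which `ι` does not see. -/
theorem ι_tensorWord (k : ℕ) (j : Fin k → J) :
    HilbertLimit.ι (tensorMap A (m j₀) h₀) k (tensorWord A m k j) =
      limitFamily A m j₀ h₀ (reducedWord j₀ k j) := by
  induction k with
  | zero => rfl
  | succ k ih =>
    rw [reducedWord]
    split_ifs with h
    · rw [← ih, ← HilbertLimit.ι_map _ k, tensorWord, h]
      rfl
    · rfl

theorem exists_ι_eq_of_le {k l : ℕ} (h : k ≤ l) (z : TensorPow A M k) :
    ∃ w, HilbertLimit.ι (tensorMap A (m j₀) h₀) k z =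
      HilbertLimit.ι (tensorMap A (m j₀) h₀) l w := by
  induction l, h using Nat.le_induction with
  | base => exact ⟨z, rfl⟩
  | succ l _ ih =>
    obtain ⟨w, hw⟩ := ih
    exact ⟨_, hw.trans (HilbertLimit.ι_map (tensorMap A (m j₀) h₀) l w).symm⟩

/-- Such a member has length `l + 1 > k` and begins with `m (j 0)`, which is orthogonal to `m j₀`;
the vector `z`, moved to the same level, begins with `m j₀`. -/
theorem ip_ι_limitFamily_eq_zero (hm : IsParsevalFrame A m) (k : ℕ) (z : TensorPow A M k)
    {p : Option (Σ k : ℕ, {j : Fin (k + 1) → J // j 0 ≠ j₀})}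
    (hp : p ∉ Set.range (reducedWord j₀ k)) :
    ip A (HilbertLimit.ι (tensorMap A (m j₀) h₀) k z) (limitFamily A m j₀ h₀ p) = 0 := by
  match p with
  | none => exact absurd (none_mem_range_reducedWord j₀ k) hp
  | some ⟨l, j, hj⟩ =>
    have hkl : k ≤ l := not_lt.mp fun h => hp (some_mem_range_reducedWord j₀ ⟨l, j, hj⟩ h)
    obtain ⟨w, hw⟩ := exists_ι_eq_of_le h₀ hkl z
    -- One further application of `T_l` raises `w` from level `l` to level `l + 1`, as `m j₀ ⊗ w`.
    rw [hw, ← HilbertLimit.ι_map]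
    refine (IsometricMap.ip_map _ _ _).trans ?_
    refine (ip_tensorCons A _ _ _ _).trans ?_
    rw [hm.ip_eq_zero h₀ hj, zero_smul, ip_zero_left]

theorem isParsevalFrame_limitFamily (hm : IsParsevalFrame A m) :
    IsParsevalFrame A (limitFamily A m j₀ h₀) := by
  refine isParsevalFrame_completion fun z => ?_
  obtain ⟨k, x, rfl⟩ := HilbertLimit.Alg.exists_mk _ z
  -- Members outside the range of `reducedWord j₀ k` contribute zero, so the sum over the family
  -- becomes a sum over words of length `k`.
  refine ((reducedWord_injective j₀ k).hasSum_iff fun p hp => ?_).mp ?_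
  · exact (congrArg (· * _) (ip_ι_limitFamily_eq_zero h₀ hm k x hp)).trans (zero_mul _)
  · have h := isParsevalFrame_tensorWord hm k x
    have h1 : ip A x x = ip A (HilbertLimit.Alg.mk (tensorMap A (m j₀) h₀) k x)
      (HilbertLimit.Alg.mk (tensorMap A (m j₀) h₀) k x) := (HilbertLimit.Alg.ip_mk_mk _ k x x).symm
    rw [← h1]
    refine h.congr_fun fun j => ?_
    rw [← IsometricMap.ip_map (HilbertLimit.ι (tensorMap A (m j₀) h₀) k) x,
      ← IsometricMap.ip_map (HilbertLimit.ι (tensorMap A (m j₀) h₀) k) _ x, ι_tensorWord]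
    rfl

theorem isOrthonormalBasis_limitFamily (hm : IsParsevalFrame A m) (h : IsOrthonormalBasis A m) :
    IsOrthonormalBasis A (limitFamily A m j₀ h₀) := by
  have h1 : ∀ p, ip A (limitFamily A m j₀ h₀ p) (limitFamily A m j₀ h₀ p) = 1 := fun p => by
    obtain ⟨k, ⟨j, rfl⟩, -⟩ := exists_mem_range_reducedWord j₀ p p
    rw [← ι_tensorWord, IsometricMap.ip_map, ip_tensorWord_self h.1]
  have h0 : ∀ p q, p ≠ q → ip A (limitFamily A m j₀ h₀ p) (limitFamily A m j₀ h₀ q) = 0 := by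
    intro p q hpq
    obtain ⟨k, ⟨i, rfl⟩, ⟨j, rfl⟩⟩ := exists_mem_range_reducedWord j₀ p q
    rw [← ι_tensorWord, ← ι_tensorWord, IsometricMap.ip_map,
      ip_tensorWord_of_ne h.1 h.2.1 k i j fun hij => hpq (congrArg _ hij)]
  exact ⟨h1, h0, (isParsevalFrame_limitFamily h₀ hm).dense_span h1 h0⟩

end LimitFrame

theorem mainTheorem6 {A : Type u} [CStarAlgebra A] [PartialOrder A] [StarOrderedRing A]
    {M : Type u} [NormedAddCommGroup M] [NormedSpace ℂ M] [Module Aᵐᵒᵖ M] [Module A M]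
    [EssentialCorrespondence A M]
    {J : Type w} [Countable J] (m : J → M) (hm : IsParsevalFrame A m)
    (j₀ : J) (h₀ : PreHilbertModule.ip A (m j₀) (m j₀) = 1) :
    IsParsevalFrame A (limitFamily A m j₀ h₀) ∧
      (IsOrthonormalBasis A m → IsOrthonormalBasis A (limitFamily A m j₀ h₀)) :=
  ⟨isParsevalFrame_limitFamily h₀ hm, isOrthonormalBasis_limitFamily h₀ hm⟩
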